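/- **Setting.** Let $D\in\mathbb N$. An *SRUW specification* $(K,m,r,l,\mathbb V)$ consists of a number of classes $K$, covariance forms $m,r,l$, and roles $\mathbb V=(\mathbb S,\mathbb R,\mathbb U,\mathbb W)$ with $\{1,\dots,D\}=\mathbb S\sqcup\mathbb U\sqcup\mathbb W$, $\mathbb S\ne\emptyset$, $\mathbb R\subseteq\mathbb S$, and $\mathbb R=\emptyset$ if $\mathbb U=\emptyset$. Here $m$ is one of the fourteen volume–shape–orientation forms of $(\Sigma_1,\dots,\Sigma_K)$: $\Sigma_k=\lambda_kQ_kA_kQ_k^{\top}$ with $\lambda_k>0$, $Q_k$ orthogonal, $A_k$ diagonal and positive with $\det A_k=1$, where the volume $\lambda_k$ is equal across classes or free, the shape $A_k$ is the identity, equal or free, the orientation $Q_k$ is the identity, equal or free, and an identity shape goes with the identity orientation. Each of $r,l$ is one of the forms spherical $[LI]$, diagonal $[LB]$, general $[LC]$. The parameters are $\theta=(\pi,\mu,\Sigma,a,\beta,\Omega,\gamma,\Gamma)$ with $\pi_k>0$, $\sum_k\pi_k=1$ and positive definite $\Sigma_k,\Omega,\Gamma$, together with class-specific missingness parameters $\psi_1,\dots,\psi_K$.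 In class $k$ the data vector $y\in\mathbb R^D$ has density $$f_k(y)=\mathcal N(y^{\mathbb S}\mid\mu_k,\Sigma_k)\,\mathcal N(y^{\mathbb U}\mid a+y^{\mathbb R}\beta,\Omega)\,\mathcal N(y^{\mathbb W}\mid\gamma,\Gamma),$$ and (MNARz mechanism), independently of $y$ given the class, each variable is missing with probability $\rho(\psi_k)$, independently of the others, where $\rho$ is a known injective function with values in $[0,1)$. With $c_d=1$ if $y_d$ is missing, the density of the observed data $(y^o,c)$ is $$f(y^o,c)=\int\sum_{k=1}^K\pi_k f_k(y^o,y^{\mathrm m})\prod_{d=1}^D\rho(\psi_k)^{c_d}(1-\rho(\psi_k))^{1-c_d}\,dy^{\mathrm m}.$$ The parameters are *admissible* if: 1. the couples $(\mu_k,\Sigma_k)$ are pairwise distinct, and for every proper subset $s\subsetneq\mathbb S$ (including $s=\emptyset$), with $\bar s=\mathbb S\setminus s$, there are $k<k'$ such that $\mu_{k,\bar s|s}\neq\mu_{k',\bar s|s}$ or $\Sigma_{k,\bar s|s}\ne\Sigma_{k',\bar s|s}$ or $\Sigma_{k,\bar s\bar s|s}\neq\Sigma_{k',\bar s\bar s|s}$,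 where $\Sigma_{k,\bar s|s}=\Sigma_{k,\bar ss}\Sigma_{k,ss}^{-1}$, $\mu_{k,\bar s|s}=\mu_{k,\bar s}-\Sigma_{k,\bar s|s}\mu_{k,s}$ and $\Sigma_{k,\bar s\bar s|s}=\Sigma_{k,\bar s\bar s}-\Sigma_{k,\bar s|s}\Sigma_{k,s\bar s}$; 2. if $\mathbb U\ne\emptyset$, every $j\in\mathbb R$ has some $u\in\mathbb U$ with $\beta_{ju}\neq0$, and every $u\in\mathbb U$ has some $j\in\mathbb R$ with $\beta_{ju}\ne0$; 3. $\Omega$ and $\Gamma$ respect the forms $r$ and $l$ exactly ($[LI]$: a scalar matrix; $[LB]$: a diagonal matrix with at least two different eigenvalues; $[LC]$: a nonzero entry off the diagonal), and $(\Sigma_k)_k$ respects $m$ exactly (it has form $m$, and every form that it has contains $m$ as a special case). **Theorem.** Suppose that two admissible SRUW–MNARz models $(K,m,r,l,\mathbb V,\theta,\psi)$ and $(K^*,m^*,r^*,l^*,\mathbb V^*,\theta^*,\psi^*)$, with the same $D$ and $\rho$, have the same observed-data density: $f(y^o,c)=f^*(y^o,c)$ for every missingness pattern $c\in\{0,1\}^D$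 and every $y^o$. Then $(K,m,r,l,\mathbb V)=(K^*,m^*,r^*,l^*,\mathbb V^*)$, and there is a permutation $\sigma$ of the class labels with $\mu^*_k=\mu_{\sigma(k)}$ and $\Sigma^*_k=\Sigma_{\sigma(k)}$ for all $k$, and $(a,\beta,\Omega,\gamma,\Gamma)=(a^*,\beta^*,\Omega^*,\gamma^*,\Gamma^*)$. If moreover $\mathbb S\neq\{1,\dots,D\}$, or there is a variable $d\in\mathbb S$ such that the Gaussian distributions of the classes on the variables $\mathbb S\setminus\{d\}$ are pairwise distinct, then for the same $\sigma$ also $\pi^*_k=\pi_{\sigma(k)}$ and $\psi^*_k=\psi_{\sigma(k)}$ for all $k$, so that all parameters agree up to the permutation of labels. -/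

import Mathlib

open MeasureTheory

noncomputable section

namespace SRUW

/-! ### Covariance forms -/

/-- The three letters of the usual three-letter names (`EII`, `VEV`, ...) of the parsimonious
Gaussian mixture forms: identity, equal across classes, variable across classes. -/
inductive Level
  | I | E | V

/-- The order `I < E < V`, as a rank. -/
def Level.rank : Level → ℕ
  | .I => 0
  | .E => 1
  | .V => 2

/-- The fourteen covariance structures of a Gaussian mixture given by volume, shape and
orientation: the volume is `E` or `V`, and a spherical shape goes with the orientation `I`. -/
structure MixForm where
  vol : Level
  shape : Level
  orient : Level
  vol_ne : vol ≠ Level.I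
  spherical : shape = Level.I → orient = Level.I

/-- `m` is a special case of `m'` (volume, shape and orientation of `m` are at most as free). -/
def MixForm.le (m m' : MixForm) : Prop :=
  m.vol.rank ≤ m'.vol.rank ∧ m.shape.rank ≤ m'.shape.rank ∧ m.orient.rank ≤ m'.orient.rank

/-- A family indexed by the classes obeys a letter: it is the identity `e` in every class, it is
the same in all classes, or it is free. -/
def Level.Holds {κ α : Type*} (e : α) (f : κ → α) : Level → Prop
  | .I => ∀ k, f k = e
  | .E => ∀ k k', f k = f k'
  | .V => True

/-- The class covariances have form `m`: `C k = vol k • (Q k * diag (A k) * (Q k)ᵀ)` with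
`vol k > 0`, `Q k` orthogonal, `A k` positive with product one, where volume, shape `A` and
orientation `Q` obey the letters of `m`. -/
def MixForm.Respects {κ ι : Type*} [Fintype ι] [DecidableEq ι] (m : MixForm)
    (C : κ → Matrix ι ι ℝ) : Prop :=
  ∃ (vol : κ → ℝ) (A : κ → ι → ℝ) (Q : κ → Matrix ι ι ℝ),
    (∀ k, 0 < vol k) ∧
    (∀ k i, 0 < A k i) ∧ (∀ k, ∏ i, A k i = 1) ∧
    (∀ k, Q k ∈ Matrix.orthogonalGroup ι ℝ) ∧
    (∀ k, C k = vol k • (Q k * Matrix.diagonal (A k) * (Q k).transpose)) ∧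
    m.vol.Holds 1 vol ∧ m.shape.Holds 1 A ∧ m.orient.Holds 1 Q

/-- The class covariances have exactly the form `m`: they have form `m`, and every form that they
have contains `m` as a special case. -/
def MixForm.Exact {κ ι : Type*} [Fintype ι] [DecidableEq ι] (m : MixForm)
    (C : κ → Matrix ι ι ℝ) : Prop :=
  m.Respects C ∧ ∀ m' : MixForm, m'.Respects C → m.le m'

/-- Forms of a single covariance matrix: spherical `[LI]`, diagonal `[LB]`, general `[LC]`. -/
inductive CovForm
  | LI | LB | LC

/-- A covariance matrix has exactly the given form: a scalar matrix; a diagonal matrix with at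
least two different eigenvalues; a matrix with a nonzero entry off the diagonal. -/
def CovForm.Exact {ι : Type*} [DecidableEq ι] (C : Matrix ι ι ℝ) : CovForm → Prop
  | .LI => ∃ t : ℝ, 0 < t ∧ C = t • (1 : Matrix ι ι ℝ)
  | .LB => (∀ i j, i ≠ j → C i j = 0) ∧ ∃ i j, C i i ≠ C j j
  | .LC => ∃ i j, i ≠ j ∧ C i j ≠ 0

/-! ### Model specifications and parameters -/

/-- Roles of the variables `1, …, D`. -/
structure Roles (D : ℕ) where
  S : Finset (Fin D)
  R : Finset (Fin D)
  U : Finset (Fin D)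
  W : Finset (Fin D)
  S_nonempty : S.Nonempty
  R_subset : R ⊆ S
  R_empty : U = ∅ → R = ∅
  disjoint_SU : Disjoint S U
  disjoint_SW : Disjoint S W
  disjoint_UW : Disjoint U W
  cover : S ∪ U ∪ W = Finset.univ

/-- A model specification `(K, m, r, l, V)`. -/
structure Spec (D : ℕ) where
  K : ℕ
  m : MixForm
  r : CovForm
  l : CovForm
  V : Roles D

/-- The parameters of an SRUW model with class-specific missingness parameters in `Ψ`: mixing
proportions, class means and covariances of the variables in `S`; intercept, coefficients and
covariance of the regression of `U` on `R`; mean and covariance of `W`; missingness parameters. -/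
structure Param {D : ℕ} (M : Spec D) (Ψ : Type*) where
  p : Fin M.K → ℝ
  μ : Fin M.K → M.V.S → ℝ
  C : Fin M.K → Matrix M.V.S M.V.S ℝ
  a : M.V.U → ℝ
  β : Matrix M.V.R M.V.U ℝ
  Ω : Matrix M.V.U M.V.U ℝ
  γ : M.V.W → ℝ
  Γ : Matrix M.V.W M.V.W ℝ
  ψ : Fin M.K → Ψ

/-- Parameters of `M'` read as parameters of `M` when the two specifications are equal. -/
def Param.cast {D : ℕ} {M M' : Spec D} {Ψ : Type*} (h : M = M') (θ : Param M' Ψ) : Param M Ψ :=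
  h ▸ θ

/-! ### Conditions on the parameters -/

section Conditional

variable {ι : Type*} [Fintype ι] [DecidableEq ι]

/-- Regression coefficients of the variables outside `s` on those in `s`. -/
def condCoef (C : Matrix ι ι ℝ) (s : Finset ι) : Matrix {i // i ∉ s} {i // i ∈ s} ℝ :=
  C.toBlock (· ∉ s) (· ∈ s) * (C.toBlock (· ∈ s) (· ∈ s))⁻¹

/-- Intercept of the regression of the variables outside `s` on those in `s`. -/
def condMean (μ : ι → ℝ) (C : Matrix ι ι ℝ) (s : Finset ι) : {i // i ∉ s} → ℝ :=
  (fun i => μ i.1) - (condCoef C s).mulVec (fun j => μ j.1)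

/-- Conditional covariance of the variables outside `s` given those in `s`. -/
def condCov (C : Matrix ι ι ℝ) (s : Finset ι) : Matrix {i // i ∉ s} {i // i ∉ s} ℝ :=
  C.toBlock (· ∉ s) (· ∉ s) - condCoef C s * C.toBlock (· ∈ s) (· ∉ s)

end Conditional

/-- The parameter set of the specification `M`, with the distinctness, nondegeneracy and exactness
conditions. -/
structure Param.Admissible {D : ℕ} {M : Spec D} {Ψ : Type*} (θ : Param M Ψ) : Prop where
  p_pos : ∀ k, 0 < θ.p k
  p_sum : ∑ k, θ.p k = 1
  C_posDef : ∀ k, (θ.C k).PosDef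
  Ω_posDef : θ.Ω.PosDef
  Γ_posDef : θ.Γ.PosDef
  distinct : ∀ k k', k ≠ k' → (θ.μ k, θ.C k) ≠ (θ.μ k', θ.C k')
  conditional : ∀ s : Finset M.V.S, s ≠ Finset.univ → ∃ k k', k < k' ∧
    (condMean (θ.μ k) (θ.C k) s ≠ condMean (θ.μ k') (θ.C k') s ∨
      condCoef (θ.C k) s ≠ condCoef (θ.C k') s ∨
      condCov (θ.C k) s ≠ condCov (θ.C k') s)
  β_row : M.V.U.Nonempty → ∀ j, ∃ u, θ.β j u ≠ 0
  β_col : M.V.U.Nonempty → ∀ u, ∃ j, θ.β j u ≠ 0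
  m_exact : M.m.Exact θ.C
  r_exact : M.r.Exact θ.Ω
  l_exact : M.l.Exact θ.Γ

/-- Some variable can go missing without making the distributions of two classes coincide. This
is automatic if there is a variable outside `S`; otherwise there has to be a variable `d` such that
the Gaussian distributions of the classes on the remaining variables are pairwise distinct. -/
def Param.SeparatedWhenIncomplete {D : ℕ} {M : Spec D} {Ψ : Type*} (θ : Param M Ψ) : Prop :=
  M.V.S ≠ Finset.univ ∨
  ∃ d : M.V.S, ∀ k k', k ≠ k' →
    (∃ i, i ≠ d ∧ θ.μ k i ≠ θ.μ k' i) ∨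
    (∃ i j, i ≠ d ∧ j ≠ d ∧ θ.C k i j ≠ θ.C k' i j)

/-! ### Densities -/

/-- The density of the Gaussian distribution with mean `μ` and covariance matrix `C`. -/
def gaussianDensity {ι : Type*} [Fintype ι] [DecidableEq ι] (μ : ι → ℝ) (C : Matrix ι ι ℝ)
    (x : ι → ℝ) : ℝ :=
  (Real.sqrt ((2 * Real.pi) ^ Fintype.card ι * C.det))⁻¹ *
    Real.exp (-(1 / 2) * ((x - μ) ⬝ᵥ C⁻¹.mulVec (x - μ)))

/-- The density of the full data vector in class `k`. -/
def Param.classDensity {D : ℕ} {M : Spec D} {Ψ : Type*} (θ : Param M Ψ) (k : Fin M.K)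
    (y : Fin D → ℝ) : ℝ :=
  gaussianDensity (θ.μ k) (θ.C k) (fun i => y i) *
    gaussianDensity (θ.a + Matrix.vecMul (fun j : M.V.R => y j) θ.β) θ.Ω (fun u => y u) *
    gaussianDensity θ.γ θ.Γ (fun w => y w)

/-- The probability of the missingness pattern `c` (`true` means missing) when every variable is
missing with probability `t`, independently. -/
def maskProb {D : ℕ} (t : ℝ) (c : Fin D → Bool) : ℝ :=
  ∏ d, if c d = true then t else 1 - t

/-- The full data vector with observed part `yo` and missing part `ym`. -/
def assemble {D : ℕ} (c : Fin D → Bool) (yo : {d // c d = false} → ℝ)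
    (ym : {d // c d = true} → ℝ) : Fin D → ℝ :=
  fun d => if h : c d = true then ym ⟨d, h⟩ else yo ⟨d, Bool.eq_false_iff.mpr h⟩

/-- The density of the observed data `(yo, c)`: the joint density of the data vector and the
missingness pattern, with the missing variables integrated out. -/
def Param.observedDensity {D : ℕ} {M : Spec D} {Ψ : Type*} (θ : Param M Ψ) (ρ : Ψ → ℝ)
    (c : Fin D → Bool) (yo : {d // c d = false} → ℝ) : ℝ :=
  ∫ ym : {d // c d = true} → ℝ,
    ∑ k, θ.p k * (θ.classDensity k (assemble c yo ym) * maskProb (ρ (θ.ψ k)) c)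

end SRUW

end

open MeasureTheory

noncomputable section

/-! ### Linear independence of exponentials of polynomials -/

namespace SRUW

open Filter Topology

/-! Each class density is a positive multiple of the exponential of a quadratic polynomial, and
exponentials of polynomials that differ by more than a constant are linearly independent: along a
suitable line one of them outgrows the others. The complete-data pattern has positive weights
because `ρ < 1`, so it alone determines the class densities up to relabelling and positive factors
(`IsExpPoly.exists_equiv`).

The roles come next. A class density is a Gaussian in the variables of `S` times a factor common to
all classes, so ratios of class densities see only `S`. If the other model had a smaller clustering
set within `S`, these ratios would depend only on the shared variables `s`, and all classes would
have the same conditional law given `s` (`conditional_eq_of_ratio`), against admissibility. Hence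
the sets `S` agree. With the variables in `S` fixed, the common factor is a Gaussian in the
remaining ones, so its mean function and covariance are determined. Increments of the mean function
are the entries of `β`, whose nonzero rows and columns reveal `R` and `U`. Exactness then fixes the
covariance forms.

For the mechanism, a second pattern is compared, with one variable `d` missing. If the marginal
class densities stay linearly independent, it yields `π ρ (1 - ρ) ^ (D - 1)` besides the `π (1 - ρ)
^ D` of complete data. The quotient is the odds `ρ / (1 - ρ)`, which determine `ρ`, then `ψ` and
`π`. -/

/-- Exponentials of real polynomials that differ by nonconstant polynomials are linearly
independent. -/
theorem sum_mul_exp_polynomial_eq_zero {ι : Type*} (p : ι → Polynomial ℝ)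
    (hp : ∀ i j, i ≠ j → 0 < (p i - p j).degree) (s : Finset ι) (w : ι → ℝ)
    (h : ∀ t : ℝ, ∑ i ∈ s, w i * Real.exp ((p i).eval t) = 0) : ∀ i ∈ s, w i = 0 := by
  classical
  by_contra! hne
  obtain ⟨i₁, hi₁, hw₁⟩ := hne
  set s' : Finset ι := s.filter (fun i => w i ≠ 0) with hs'
  -- `r i j` says that `p i` outgrows `p j`. An `r`-minimal index `i₀` is a dominant exponent among
  -- those with nonzero weight.
  let r : s' → s' → Prop := fun i j =>
    Tendsto (fun t => (p i.1 - p j.1).eval t) atTop atTop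
  have : IsTrans s' r := ⟨fun i j k hij hjk => by
    have := hij.atTop_add_atTop hjk
    refine this.congr fun t => ?_
    simp⟩
  have : Std.Irrefl r := ⟨fun i hi => by
    simp only [r, sub_self, Polynomial.eval_zero] at hi
    exact not_tendsto_const_atTop (0 : ℝ) atTop hi⟩
  have hwf : WellFounded r := Finite.wellFounded_of_trans_of_irrefl r
  obtain ⟨i₀, -, hmax⟩ := hwf.has_min Set.univ ⟨⟨i₁, by simp [hs', hi₁, hw₁]⟩, trivial⟩
  have hi₀ := Finset.mem_filter.1 i₀.2
  -- After division by the dominant exponential every other term tends to zero: its exponent is a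
  -- nonconstant polynomial, hence tends to `±∞`, and `+∞` is excluded by the choice of `i₀`.
  have hlim : ∀ i ∈ s', Tendsto (fun t => w i * Real.exp ((p i - p i₀).eval t)) atTop
      (𝓝 (if i = i₀.1 then w i else 0)) := by
    intro i hi
    by_cases hii : i = i₀.1
    · subst hii
      simp
    · have hd := hp i i₀ hii
      have hbot : Tendsto (fun t => (p i - p i₀).eval t) atTop atBot := by
        refine Polynomial.tendsto_atBot_of_leadingCoeff_nonpos _ hd ?_
        by_contra! hl
        exact hmax ⟨i, hi⟩ trivial
          (Polynomial.tendsto_atTop_of_leadingCoeff_nonneg _ hd hl.le)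
      simpa [hii] using (Real.tendsto_exp_atBot.comp hbot).const_mul (w i)
  have hsum := tendsto_finsetSum s' hlim
  have hzero : ∀ t, ∑ i ∈ s', w i * Real.exp ((p i - p i₀).eval t) = 0 := by
    intro t
    have h1 : ∑ i ∈ s', w i * Real.exp ((p i).eval t) = 0 := by
      rw [← h t, hs', Finset.sum_filter]
      refine Finset.sum_congr rfl fun i _ => ?_
      by_cases hwi : w i = 0 <;> simp [hwi]
    calc _ = (∑ i ∈ s', w i * Real.exp ((p i).eval t)) * Real.exp (-(p i₀).eval t) := by
          rw [Finset.sum_mul]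
          refine Finset.sum_congr rfl fun i _ => ?_
          rw [Polynomial.eval_sub, sub_eq_add_neg, Real.exp_add, mul_assoc]
      _ = 0 := by rw [h1, zero_mul]
  simp only [hzero, Finset.sum_ite_eq', i₀.2, if_true] at hsum
  exact hi₀.2 (tendsto_nhds_unique hsum tendsto_const_nhds)

/-- Exponentials of distinct real polynomials without constant term are linearly independent. -/
theorem linearIndependent_exp_mvPolynomial {n : Type*} :
    LinearIndependent ℝ (fun (q : {q : MvPolynomial n ℝ // MvPolynomial.constantCoeff q = 0})
      (x : n → ℝ) => Real.exp (MvPolynomial.eval x q.1)) := by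
  classical
  rw [linearIndependent_iff']
  intro s w h
  -- A direction `v` at which all the distinct polynomials take distinct values: the product of
  -- their differences is a nonzero polynomial, so it does not vanish everywhere.
  obtain ⟨v, hv⟩ : ∃ v : n → ℝ, MvPolynomial.eval v
      (∏ i ∈ s, ∏ j ∈ s, if i = j then 1 else i.1 - j.1) ≠ 0 := by
    by_contra! hz
    have h0 : (∏ i ∈ s, ∏ j ∈ s, if i = j then 1 else i.1 - j.1) = 0 :=
      MvPolynomial.funext fun v => by simpa using hz v
    simp only [Finset.prod_eq_zero_iff] at h0
    obtain ⟨i, -, j, -, hij⟩ := h0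
    by_cases e : i = j
    · simp [e] at hij
    · simp only [e, if_false, sub_eq_zero] at hij
      exact e (Subtype.ext hij)
  simp only [map_prod, Finset.prod_ne_zero_iff] at hv
  let p : s → Polynomial ℝ := fun i =>
    MvPolynomial.eval₂ Polynomial.C (fun k => Polynomial.C (v k) * Polynomial.X) i.1.1
  have hpe : ∀ i t, (p i).eval t = MvPolynomial.eval (fun k => v k * t) i.1.1 := by
    intro i t
    simp only [p]
    rw [← Polynomial.coe_evalRingHom, MvPolynomial.hom_eval₂]
    have : (Polynomial.evalRingHom t).comp Polynomial.C = RingHom.id ℝ := by ext; simp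
    rw [this, MvPolynomial.eval₂_id]
    congr 2
    funext k
    simp
  -- On the line `t ↦ t v` two exponents agree at `t = 0`, having no constant term, and differ at `t
  -- = 1`. So their difference is nonconstant.
  have hdeg : ∀ i j, i ≠ j → 0 < (p i - p j).degree := by
    intro i j hij
    by_contra! hd
    have hC := Polynomial.eq_C_of_degree_le_zero hd
    have e0 : (p i - p j).eval 0 = (p i - p j).eval 1 := by rw [hC]; simp
    simp only [Polynomial.eval_sub, hpe, mul_zero, mul_one] at e0
    have hz : ∀ q : {q : MvPolynomial n ℝ // MvPolynomial.constantCoeff q = 0},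
        MvPolynomial.eval (fun _ => (0 : ℝ)) q.1 = 0 := fun q =>
      (RingHom.congr_fun MvPolynomial.eval_zero q.1).trans q.2
    rw [hz, hz, sub_self] at e0
    have := hv i.1 i.2 j.1 j.2
    rw [if_neg (fun e => hij (Subtype.ext e)), map_sub] at this
    exact this e0.symm
  have key := sum_mul_exp_polynomial_eq_zero p hdeg Finset.univ (fun i => w i.1) (fun t => by
    have := congrFun h (fun k => v k * t)
    simp only [Finset.sum_apply, Pi.smul_apply, smul_eq_mul, Pi.zero_apply] at this
    refine Eq.trans ?_ this
    rw [← Finset.sum_coe_sort s]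
    simp only [hpe])
  exact fun i hi => key ⟨i, hi⟩ (Finset.mem_univ _)

/-- Positive multiples of exponentials of polynomials in finitely many real variables. -/
def IsExpPoly {n : Type*} (f : (n → ℝ) → ℝ) : Prop :=
  ∃ (A : ℝ) (q : MvPolynomial n ℝ), 0 < A ∧ ∀ x, f x = A * Real.exp (MvPolynomial.eval x q)

theorem IsExpPoly.mul {n : Type*} {f g : (n → ℝ) → ℝ} (hf : IsExpPoly f) (hg : IsExpPoly g) :
    IsExpPoly (fun x => f x * g x) := by
  obtain ⟨A, q, hA, hq⟩ := hf
  obtain ⟨B, r, hB, hr⟩ := hg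
  refine ⟨A * B, q + r, mul_pos hA hB, fun x => ?_⟩
  simp only [hq, hr, map_add, Real.exp_add]
  ring

theorem IsExpPoly.exists_normalized {n : Type*} {f : (n → ℝ) → ℝ} (hf : IsExpPoly f) :
    ∃ (A : ℝ) (q : {q : MvPolynomial n ℝ // MvPolynomial.constantCoeff q = 0}),
      0 < A ∧ ∀ x, f x = A * Real.exp (MvPolynomial.eval x q.1) := by
  obtain ⟨A, q, hA, hq⟩ := hf
  refine ⟨A * Real.exp (MvPolynomial.constantCoeff q),
    ⟨q - MvPolynomial.C (MvPolynomial.constantCoeff q), by simp⟩, by positivity, fun x => ?_⟩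
  rw [hq, mul_assoc, ← Real.exp_add]
  simp

/-- Pairwise nonproportional exponentials of polynomials are linearly independent. -/
theorem IsExpPoly.linearIndependent {n κ : Type*} {f : κ → (n → ℝ) → ℝ}
    (hf : ∀ k, IsExpPoly (f k))
    (hne : ∀ k l, (∃ c : ℝ, ∀ x, f k x = c * f l x) → k = l) : LinearIndependent ℝ f := by
  choose A q hA hq using fun k => (hf k).exists_normalized
  have hinj : Function.Injective q := fun k l hkl => hne k l ⟨A k / A l, fun x => by
    rw [hq, hq l, hkl, ← mul_assoc, div_mul_cancel₀ _ (hA l).ne']⟩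
  have h1 := (linearIndependent_exp_mvPolynomial (n := n)).comp q hinj
  have h2 := h1.units_smul (fun k => Units.mk0 (A k) (hA k).ne')
  convert h2 using 1
  funext k x
  simp [hq, Units.smul_def]

/-- Two positive mixtures of pairwise nonproportional exponentials of polynomials that agree have
the same components, up to proportionality. -/
theorem IsExpPoly.exists_equiv {n κ κ' : Type*} [Fintype κ] [Fintype κ']
    {f : κ → (n → ℝ) → ℝ} {f' : κ' → (n → ℝ) → ℝ}
    (hf : ∀ k, IsExpPoly (f k)) (hf' : ∀ k, IsExpPoly (f' k))
    (hne : ∀ k l, (∃ c : ℝ, ∀ x, f k x = c * f l x) → k = l)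
    (hne' : ∀ k l, (∃ c : ℝ, ∀ x, f' k x = c * f' l x) → k = l)
    {w : κ → ℝ} {w' : κ' → ℝ} (hw : ∀ k, 0 < w k) (hw' : ∀ k, 0 < w' k)
    (h : ∀ x, ∑ k, w k * f k x = ∑ k, w' k * f' k x) :
    ∃ e : κ' ≃ κ, ∀ k, ∃ c : ℝ, 0 < c ∧ ∀ x, f' k x = c * f (e k) x := by
  classical
  choose A q hA hq using fun k => (hf k).exists_normalized
  choose A' q' hA' hq' using fun k => (hf' k).exists_normalized
  have hinj : Function.Injective q := fun k l hkl => hne k l ⟨A k / A l, fun x => by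
    rw [hq, hq l, hkl, ← mul_assoc, div_mul_cancel₀ _ (hA l).ne']⟩
  have hinj' : Function.Injective q' := fun k l hkl => hne' k l ⟨A' k / A' l, fun x => by
    rw [hq', hq' l, hkl, ← mul_assoc, div_mul_cancel₀ _ (hA' l).ne']⟩
  -- Both mixtures become finitely supported coefficient functions on the normalized exponents.
  -- Independence makes these equal, and since all coefficients are positive, the sets of exponents
  -- coincide.
  have hfs : ∑ k, Finsupp.single (q k) (w k * A k) =
      ∑ k, Finsupp.single (q' k) (w' k * A' k) := by
    refine (linearIndependent_exp_mvPolynomial (n := n)) ?_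
    simp only [map_sum, Finsupp.linearCombination_single]
    funext x
    simp only [Finset.sum_apply, Pi.smul_apply, smul_eq_mul, mul_assoc]
    simpa only [hq, hq'] using h x
  have hr : ∀ k, ∃ l, q' l = q k := by
    intro k
    by_contra! hc
    have := DFunLike.congr_fun hfs (q k)
    simp only [Finsupp.finsetSum_apply, Finsupp.single_apply, hinj.eq_iff, hc, if_false,
      Finset.sum_const_zero, Finset.sum_ite_eq', Finset.mem_univ, if_true] at this
    exact (mul_pos (hw k) (hA k)).ne' this
  have hr' : ∀ l, ∃ k, q k = q' l := by
    intro l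
    by_contra! hc
    have := DFunLike.congr_fun hfs (q' l)
    simp only [Finsupp.finsetSum_apply, Finsupp.single_apply, hinj'.eq_iff, hc, if_false,
      Finset.sum_const_zero, Finset.sum_ite_eq', Finset.mem_univ, if_true] at this
    exact (mul_pos (hw' l) (hA' l)).ne this
  choose g hg using hr'
  have hbij : Function.Bijective g := by
    refine ⟨fun a b hab => hinj' ?_, fun k => ?_⟩
    · rw [← hg, ← hg, hab]
    · obtain ⟨l, hl⟩ := hr k
      exact ⟨l, hinj (by rw [hg, hl])⟩
  refine ⟨Equiv.ofBijective g hbij, fun k => ⟨A' k / A (g k), div_pos (hA' k) (hA _),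
    fun x => ?_⟩⟩
  rw [Equiv.ofBijective_apply, hq', hq, hg, ← mul_assoc, div_mul_cancel₀ _ (hA _).ne']

end SRUW

/-! ### Gaussian densities: uniqueness of parameters and conditioning -/

namespace SRUW

section Gaussian

theorem posDef_toBlock {ι : Type*} {C : Matrix ι ι ℝ} (hC : C.PosDef) (s : Finset ι) :
    (C.toBlock (· ∈ s) (· ∈ s)).PosDef :=
  hC.submatrix Subtype.val_injective

theorem submatrix_sumCompl {ι : Type*} [DecidableEq ι] {C : Matrix ι ι ℝ} (hC : C.PosDef) (s : Finset ι) :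
    C.submatrix (Equiv.sumCompl (· ∈ s)) (Equiv.sumCompl (· ∈ s)) =
      Matrix.fromBlocks (C.toBlock (· ∈ s) (· ∈ s)) (C.toBlock (· ∈ s) (· ∉ s))
        (C.toBlock (· ∈ s) (· ∉ s)).transpose (C.toBlock (· ∉ s) (· ∉ s)) := by
  have hs : ∀ i j, C i j = C j i := fun i j => by simpa using (hC.1.apply i j).symm
  ext (i | i) (j | j) <;> simp [Matrix.toBlock_apply, hs j.1 i.1]

theorem toBlock_transpose {ι : Type*} {C : Matrix ι ι ℝ} (hC : C.PosDef) (s : Finset ι) :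
    (C.toBlock (· ∈ s) (· ∉ s)).transpose = C.toBlock (· ∉ s) (· ∈ s) := by
  have hs : ∀ i j, C i j = C j i := fun i j => by simpa using (hC.1.apply i j).symm
  ext i j
  simp [Matrix.toBlock_apply, hs i.1 j.1]

variable {ι : Type*} [Fintype ι] [DecidableEq ι]

theorem gaussianDensity_pos (μ : ι → ℝ) {C : Matrix ι ι ℝ} (hC : C.PosDef) (x : ι → ℝ) :
    0 < gaussianDensity μ C x := by
  have := hC.det_pos
  unfold gaussianDensity
  positivity

theorem gaussianDensity_reindex {κ : Type*} [Fintype κ] [DecidableEq κ] (e : κ ≃ ι)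
    (μ : ι → ℝ) (C : Matrix ι ι ℝ) (x : ι → ℝ) :
    gaussianDensity (μ ∘ e) (C.submatrix e e) (x ∘ e) = gaussianDensity μ C x := by
  unfold gaussianDensity
  rw [Matrix.det_submatrix_equiv_self, Fintype.card_congr e, Matrix.inv_submatrix_equiv,
    Matrix.submatrix_mulVec_equiv]
  have h1 : (x ∘ e - μ ∘ e) ∘ e.symm = x - μ := by
    funext i; simp
  rw [h1, show x ∘ e - μ ∘ e = (x - μ) ∘ e from rfl]
  congr 3
  exact Equiv.sum_comp e (fun i => (x - μ) i * C⁻¹.mulVec (x - μ) i)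

/-- The value of the quadratic form of the inverse matrix at an image vector. -/
theorem dotProduct_inv_mulVec_mulVec {C : Matrix ι ι ℝ} (hC : C.PosDef) (w : ι → ℝ) :
    C.mulVec w ⬝ᵥ C⁻¹.mulVec (C.mulVec w) = w ⬝ᵥ C.mulVec w := by
  have := hC.isUnit.invertible
  rw [Matrix.mulVec_mulVec, Matrix.inv_mul_of_invertible, Matrix.one_mulVec, dotProduct_comm]

/-- Proportional Gaussian densities have the same mean and covariance. -/
theorem gaussianDensity_proportional {μ μ' : ι → ℝ} {C C' : Matrix ι ι ℝ} (hC : C.PosDef)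
    (hC' : C'.PosDef) {c : ℝ} (h : ∀ x, gaussianDensity μ C x = c * gaussianDensity μ' C' x) :
    μ = μ' ∧ C = C' := by
  set P := C⁻¹ with hP
  set P' := C'⁻¹ with hP'
  have hPd : P.PosDef := hC.inv
  have hPd' : P'.PosDef := hC'.inv
  have hPs : P'.transpose = P' := by simpa using hPd'.1.eq
  have hPs0 : P.transpose = P := by simpa using hPd.1.eq
  have hsymm : ∀ {Q : Matrix ι ι ℝ}, Q.transpose = Q → ∀ v w : ι → ℝ,
      w ⬝ᵥ Q.mulVec v = v ⬝ᵥ Q.mulVec w := fun {Q} hQ v w => by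
    rw [Matrix.dotProduct_mulVec, ← Matrix.mulVec_transpose, hQ, dotProduct_comm]
  -- Cross-multiplying at two points eliminates both `c` and the normalizing constants.
  have hratio : ∀ x y, gaussianDensity μ C x * gaussianDensity μ' C' y =
      gaussianDensity μ C y * gaussianDensity μ' C' x := fun x y => by
    rw [h x, h y]; ring
  have hq : ∀ x y, (x - μ) ⬝ᵥ P.mulVec (x - μ) + (y - μ') ⬝ᵥ P'.mulVec (y - μ') =
      (y - μ) ⬝ᵥ P.mulVec (y - μ) + (x - μ') ⬝ᵥ P'.mulVec (x - μ') := by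
    intro x y
    have h1 := hratio x y
    have hd := hC.det_pos
    have hd' := hC'.det_pos
    unfold gaussianDensity at h1
    have h2 : Real.exp (-(1 / 2) * ((x - μ) ⬝ᵥ P.mulVec (x - μ)) +
        -(1 / 2) * ((y - μ') ⬝ᵥ P'.mulVec (y - μ'))) =
        Real.exp (-(1 / 2) * ((y - μ) ⬝ᵥ P.mulVec (y - μ)) +
        -(1 / 2) * ((x - μ') ⬝ᵥ P'.mulVec (x - μ'))) := by
      rw [Real.exp_add, Real.exp_add]
      refine mul_left_cancel₀ (a := (√((2 * Real.pi) ^ Fintype.card ι * C.det))⁻¹ *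
        (√((2 * Real.pi) ^ Fintype.card ι * C'.det))⁻¹) (by positivity) ?_
      linear_combination h1
    linarith [Real.exp_injective h2]
  set δ := μ - μ' with hδ
  -- Expansion around `μ`. Comparing `v` with `-v` then kills the linear term, positive definiteness
  -- gives `δ = 0`, and polarization identifies the two quadratic forms.
  have hv : ∀ v : ι → ℝ, v ⬝ᵥ P.mulVec v = v ⬝ᵥ P'.mulVec v + 2 * (v ⬝ᵥ P'.mulVec δ) := by
    intro v
    have h1 := hq (v + μ) μ
    rw [add_sub_cancel_right, sub_self, add_sub_assoc, ← hδ, Matrix.mulVec_add,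
      Matrix.mulVec_zero, zero_dotProduct, dotProduct_add, add_dotProduct, add_dotProduct,
      hsymm hPs v δ] at h1
    linarith
  have hlin : ∀ v : ι → ℝ, v ⬝ᵥ P'.mulVec δ = 0 := by
    intro v
    have h1 := hv v
    have h2 := hv (-v)
    simp only [Matrix.mulVec_neg, neg_dotProduct, dotProduct_neg, neg_neg] at h2
    linarith
  have hδ0 : δ = 0 := by
    by_contra hne
    have := hPd'.dotProduct_mulVec_pos hne
    simp only [star_trivial, hlin] at this
    exact lt_irrefl _ this
  refine ⟨sub_eq_zero.1 hδ0, ?_⟩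
  have hPP : P = P' := by
    have hbil : ∀ v w : ι → ℝ, v ⬝ᵥ P.mulVec w = v ⬝ᵥ P'.mulVec w := by
      intro v w
      have h1 := hv (v + w)
      have h2 := hv v
      have h3 := hv w
      simp only [hlin, Matrix.mulVec_add, dotProduct_add, add_dotProduct, hsymm hPs v w,
        hsymm hPs0 v w] at h1 h2 h3
      linarith
    ext i j
    have := hbil (Pi.single i 1) (Pi.single j 1)
    simpa using this
  rw [← Matrix.nonsing_inv_nonsing_inv C ((Matrix.isUnit_iff_isUnit_det _).1 hC.isUnit),
    ← Matrix.nonsing_inv_nonsing_inv C' ((Matrix.isUnit_iff_isUnit_det _).1 hC'.isUnit),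
    ← hP, hPP]

/-- The determinant splits into that of `A` and that of the Schur complement. The exponent splits by
completing the square. -/
theorem gaussianDensity_fromBlocks {κ : Type*} [Fintype κ] [DecidableEq κ] (μ : ι → ℝ)
    (ν : κ → ℝ) (A : Matrix ι ι ℝ) (B : Matrix ι κ ℝ) (D : Matrix κ κ ℝ)
    (hA : A.PosDef) (hD : (D - B.transpose * A⁻¹ * B).PosDef)
    (hM : (Matrix.fromBlocks A B B.transpose D).PosDef)
    (x : ι → ℝ) (y : κ → ℝ) :
    gaussianDensity (Sum.elim μ ν) (Matrix.fromBlocks A B B.transpose D) (Sum.elim x y) =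
      gaussianDensity μ A x *
        gaussianDensity (ν + (B.transpose * A⁻¹).mulVec (x - μ)) (D - B.transpose * A⁻¹ * B) y := by
  have := hA.isUnit.invertible
  have hdA := hA.det_pos
  have hdD := hD.det_pos
  unfold gaussianDensity
  rw [mul_mul_mul_comm, ← Real.exp_add, ← mul_inv, ← Real.sqrt_mul (by positivity),
    Matrix.det_fromBlocks₁₁, Matrix.invOf_eq_nonsing_inv, Fintype.card_sum, pow_add]
  congr 1
  · congr 2
    ring
  rw [← mul_add]
  congr 2
  have hunit := hM.isUnit.invertible
  -- Writing the centred vector as an image under the block matrix turns every inverse quadratic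
  -- form into a direct one, so no block inverse is needed.
  obtain ⟨w₁, w₂, hw⟩ : ∃ (w₁ : ι → ℝ) (w₂ : κ → ℝ), Sum.elim x y - Sum.elim μ ν =
      (Matrix.fromBlocks A B B.transpose D).mulVec (Sum.elim w₁ w₂) := by
    refine ⟨fun i => (Matrix.fromBlocks A B B.transpose D)⁻¹.mulVec
      (Sum.elim x y - Sum.elim μ ν) (Sum.inl i),
      fun i => (Matrix.fromBlocks A B B.transpose D)⁻¹.mulVec
      (Sum.elim x y - Sum.elim μ ν) (Sum.inr i), ?_⟩
    have : ∀ z : ι ⊕ κ → ℝ, Sum.elim (fun i => z (Sum.inl i)) (fun i => z (Sum.inr i)) = z :=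
      fun z => Sum.elim_comp_inl_inr z
    rw [this, Matrix.mulVec_mulVec, Matrix.mul_inv_of_invertible, Matrix.one_mulVec]
  have hx : x - μ = A.mulVec (w₁ + (A⁻¹ * B).mulVec w₂) := by
    rw [Matrix.mulVec_add, Matrix.mulVec_mulVec, ← Matrix.mul_assoc,
      Matrix.mul_inv_of_invertible, Matrix.one_mul]
    funext i
    have := congrFun hw (Sum.inl i)
    simpa [Matrix.fromBlocks_mulVec] using this
  have hy : y - (ν + (B.transpose * A⁻¹).mulVec (x - μ)) =
      (D - B.transpose * A⁻¹ * B).mulVec w₂ := by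
    have h1 : y - ν = B.transpose.mulVec w₁ + D.mulVec w₂ := by
      funext i
      have := congrFun hw (Sum.inr i)
      simpa [Matrix.fromBlocks_mulVec] using this
    rw [← sub_sub, h1, hx, Matrix.mulVec_mulVec, Matrix.mul_assoc B.transpose,
      Matrix.inv_mul_of_invertible, Matrix.mul_one, Matrix.mulVec_add, Matrix.sub_mulVec,
      Matrix.mulVec_mulVec, Matrix.mul_assoc B.transpose]
    abel
  rw [hy, hx, hw, dotProduct_inv_mulVec_mulVec hM, dotProduct_inv_mulVec_mulVec hA,
    dotProduct_inv_mulVec_mulVec hD]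
  have key := Matrix.schur_complement_eq₁₁ B D w₁ w₂ hA.1
  simpa [Matrix.dotProduct_mulVec, Matrix.conjTranspose_eq_transpose_of_trivial] using key

theorem posDef_schur {κ : Type*} [Fintype κ] [DecidableEq κ] {A : Matrix ι ι ℝ}
    {B : Matrix ι κ ℝ} {D : Matrix κ κ ℝ}
    (hM : (Matrix.fromBlocks A B B.transpose D).PosDef) (hA : A.PosDef) :
    (D - B.transpose * A⁻¹ * B).PosDef := by
  have := hA.isUnit.invertible
  have hM' := hM
  rw [← Matrix.conjTranspose_eq_transpose_of_trivial] at hM' ⊢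
  refine Matrix.PosDef.of_dotProduct_mulVec_pos
    ((Matrix.IsHermitian.fromBlocks₁₁ B D hA.1).1 hM'.1) fun y hy => ?_
  -- The first component minimizes the quadratic form for given `y`, and the minimum is the value of
  -- the Schur complement at `y`.
  have h1 := hM'.dotProduct_mulVec_pos (x := Sum.elim (-((A⁻¹ * B).mulVec y)) y) (fun h => hy (by
    funext i
    exact congrFun h (Sum.inr i)))
  rwa [Matrix.dotProduct_mulVec, Matrix.schur_complement_eq₁₁ B D _ _ hA.1, neg_add_cancel,
    dotProduct_zero, zero_add, ← Matrix.dotProduct_mulVec] at h1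

theorem posDef_condCov {C : Matrix ι ι ℝ} (hC : C.PosDef) (s : Finset ι) :
    (condCov C s).PosDef := by
  have h := hC.submatrix (Equiv.sumCompl (· ∈ s)).injective
  rw [submatrix_sumCompl hC] at h
  have := posDef_schur h (posDef_toBlock hC s)
  rwa [toBlock_transpose hC] at this

/-- A Gaussian density is the product of the marginal density of the coordinates in `s` and the
conditional density of the other coordinates. -/
theorem gaussianDensity_eq_marginal_mul_conditional (μ : ι → ℝ) {C : Matrix ι ι ℝ}
    (hC : C.PosDef) (s : Finset ι) (x : ι → ℝ) :
    gaussianDensity μ C x =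
      gaussianDensity (fun i : {i // i ∈ s} => μ i) (C.toBlock (· ∈ s) (· ∈ s)) (fun i => x i) *
      gaussianDensity (condMean μ C s + (condCoef C s).mulVec (fun i => x i)) (condCov C s)
        (fun i => x i) := by
  have hM := hC.submatrix (Equiv.sumCompl (· ∈ s)).injective
  have hS := posDef_condCov hC s
  rw [← gaussianDensity_reindex (Equiv.sumCompl (· ∈ s)) μ C x, submatrix_sumCompl hC]
  rw [submatrix_sumCompl hC] at hM
  have e : ∀ z : ι → ℝ, z ∘ Equiv.sumCompl (· ∈ s) =
      Sum.elim (fun i : {i // i ∈ s} => z i) (fun i : {i // i ∉ s} => z i) := fun z => by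
    funext i
    rcases i with i | i <;> simp
  rw [e, e, gaussianDensity_fromBlocks _ _ _ _ _ (posDef_toBlock hC s)
    (posDef_schur hM (posDef_toBlock hC s)) hM, toBlock_transpose hC]
  congr 2
  rw [condMean, condCoef]
  rw [Matrix.mulVec_sub]
  abel

/-- If the ratio of two Gaussian densities only depends on the coordinates in `s`, then the
conditional distributions given these coordinates are equal. -/
theorem conditional_eq_of_ratio {μ μ' : ι → ℝ} {C C' : Matrix ι ι ℝ} (hC : C.PosDef)
    (hC' : C'.PosDef) (s : Finset ι)
    (h : ∀ x x' : ι → ℝ, (∀ i ∈ s, x i = x' i) →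
      gaussianDensity μ C x * gaussianDensity μ' C' x' =
        gaussianDensity μ' C' x * gaussianDensity μ C x') :
    condMean μ C s = condMean μ' C' s ∧ condCoef C s = condCoef C' s ∧
      condCov C s = condCov C' s := by
  -- With the coordinates in `s` fixed at `a`, the marginal factors cancel and the two conditional
  -- densities are proportional in the remaining coordinates; `c` is their ratio at `0`.
  have key : ∀ a : {i // i ∈ s} → ℝ,
      condMean μ C s + (condCoef C s).mulVec a = condMean μ' C' s + (condCoef C' s).mulVec a ∧
      condCov C s = condCov C' s := by
    intro a
    let ext : ({i // i ∉ s} → ℝ) → ι → ℝ := fun b i => if hi : i ∈ s then a ⟨i, hi⟩ else b ⟨i, hi⟩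
    have ext_in : ∀ b, (fun i : {i // i ∈ s} => ext b i) = a := fun b => by
      funext i; simp [ext]
    have ext_out : ∀ b, (fun i : {i // i ∉ s} => ext b i) = b := fun b => by
      funext i; simp [ext, i.2]
    have hpos := gaussianDensity_pos (fun i : {i // i ∈ s} => μ i) (posDef_toBlock hC s) a
    have hpos' := gaussianDensity_pos (fun i : {i // i ∈ s} => μ' i) (posDef_toBlock hC' s) a
    have hpos'' := gaussianDensity_pos (condMean μ' C' s + (condCoef C' s).mulVec a)
      (posDef_condCov hC' s) 0
    refine gaussianDensity_proportional (posDef_condCov hC s) (posDef_condCov hC' s)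
      (c := gaussianDensity (condMean μ C s + (condCoef C s).mulVec a) (condCov C s) 0 /
        gaussianDensity (condMean μ' C' s + (condCoef C' s).mulVec a) (condCov C' s) 0)
      fun b => ?_
    have h1 := h (ext b) (ext 0) (fun i hi => by simp [ext, hi])
    rw [gaussianDensity_eq_marginal_mul_conditional μ hC s (ext b),
      gaussianDensity_eq_marginal_mul_conditional μ' hC' s (ext b),
      gaussianDensity_eq_marginal_mul_conditional μ hC s (ext 0),
      gaussianDensity_eq_marginal_mul_conditional μ' hC' s (ext 0)] at h1
    simp only [ext_in, ext_out] at h1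
    rw [div_mul_eq_mul_div, eq_div_iff hpos''.ne']
    refine mul_left_cancel₀ (mul_pos hpos hpos').ne' ?_
    linear_combination h1
  -- Two affine functions of `a` agree: `a = 0` gives the intercept, unit vectors give the columns
  -- of coefficients.
  have hm : condMean μ C s = condMean μ' C' s := by simpa using (key 0).1
  refine ⟨hm, ?_, (key 0).2⟩
  ext i j
  have := congrFun (key (Pi.single j 1)).1 i
  rw [hm] at this
  simpa using this

end Gaussian

end SRUW

/-! ### Gaussian densities as exponentials of polynomials; integrating out one coordinate -/

namespace SRUW

/-- The mean may vary with the variables, which covers the regression of `U` on `R`. -/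
theorem isExpPoly_gaussianDensity {n ι : Type*} [Fintype ι] [DecidableEq ι]
    {C : Matrix ι ι ℝ} (hC : C.PosDef) (m z : (n → ℝ) → ι → ℝ)
    (h : ∀ i, ∃ q : MvPolynomial n ℝ, ∀ y, z y i - m y i = MvPolynomial.eval y q) :
    IsExpPoly (fun y => gaussianDensity (m y) C (z y)) := by
  choose q hq using h
  have hd := hC.det_pos
  refine ⟨(√((2 * Real.pi) ^ Fintype.card ι * C.det))⁻¹,
    MvPolynomial.C (-(1 / 2)) * ∑ i, q i * ∑ j, MvPolynomial.C (C⁻¹ i j) * q j,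
    by positivity, fun y => ?_⟩
  simp only [gaussianDensity, dotProduct, Matrix.mulVec, Pi.sub_apply, hq, map_mul, map_sum,
    MvPolynomial.eval_C]

section Marginal

theorem gaussianDensity_unique {κ : Type*} [Fintype κ] [DecidableEq κ] [Unique κ] (m : κ → ℝ)
    {V : Matrix κ κ ℝ} (hV : V.PosDef) (x : κ → ℝ) :
    gaussianDensity m V x = ProbabilityTheory.gaussianPDFReal (m default)
      (V default default).toNNReal (x default) := by
  have h0 : 0 < V default default := hV.diag_pos
  rw [gaussianDensity, ProbabilityTheory.gaussianPDFReal_def, Matrix.inv_subsingleton]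
  simp only [Fintype.card_unique, pow_one, Matrix.det_unique, dotProduct, Finset.univ_unique,
    Finset.sum_singleton, Matrix.mulVec_diagonal, Pi.sub_apply, Ring.inverse_eq_inv',
    Real.coe_toNNReal _ h0.le]
  congr 2
  field_simp

variable {ι : Type*} [Fintype ι] [DecidableEq ι]

instance uniqueNotMemErase (d : ι) : Unique {i // i ∉ Finset.univ.erase d} where
  default := ⟨d, by simp⟩
  uniq := fun i => Subtype.ext (by simpa using i.2)

/-- Conditioning on all coordinates but `d`: these do not change with `t`, so neither do the
marginal factor, `m` and `v`. -/
theorem gaussianDensity_update (μ : ι → ℝ) {C : Matrix ι ι ℝ} (hC : C.PosDef) (d : ι)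
    (x : ι → ℝ) : ∃ (m : ℝ) (v : NNReal), v ≠ 0 ∧ ∀ t,
      gaussianDensity μ C (Function.update x d t) =
      gaussianDensity (fun i : {i // i ∈ Finset.univ.erase d} => μ i)
        (C.toBlock (· ∈ Finset.univ.erase d) (· ∈ Finset.univ.erase d)) (fun i => x i) *
      ProbabilityTheory.gaussianPDFReal m v t := by
  set s := Finset.univ.erase d
  have hV := posDef_condCov hC s
  refine ⟨(condMean μ C s + (condCoef C s).mulVec (fun i : {i // i ∈ s} => x i)) default,
    (condCov C s default default).toNNReal, ?_, fun t => ?_⟩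
  · exact (Real.toNNReal_pos.2 hV.diag_pos).ne'
  · have e : (fun i : {i // i ∈ s} => Function.update x d t i) =
        fun i : {i // i ∈ s} => x i := by
      funext i
      exact Function.update_of_ne (Finset.ne_of_mem_erase i.2) _ _
    rw [gaussianDensity_eq_marginal_mul_conditional μ hC s, gaussianDensity_unique _ hV, e]
    congr 2
    exact Function.update_self _ _ _

theorem integrable_gaussianDensity_update (μ : ι → ℝ) {C : Matrix ι ι ℝ} (hC : C.PosDef) (d : ι)
    (x : ι → ℝ) : Integrable (fun t => gaussianDensity μ C (Function.update x d t)) := by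
  obtain ⟨m, v, -, h⟩ := gaussianDensity_update μ hC d x
  simp only [h]
  exact (ProbabilityTheory.integrable_gaussianPDFReal m v).const_mul _

theorem integral_gaussianDensity_update (μ : ι → ℝ) {C : Matrix ι ι ℝ} (hC : C.PosDef) (d : ι)
    (x : ι → ℝ) : ∫ t, gaussianDensity μ C (Function.update x d t) =
      gaussianDensity (fun i : {i // i ∈ Finset.univ.erase d} => μ i)
        (C.toBlock (· ∈ Finset.univ.erase d) (· ∈ Finset.univ.erase d)) (fun i => x i) := by
  obtain ⟨m, v, hv, h⟩ := gaussianDensity_update μ hC d x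
  simp only [h]
  rw [integral_const_mul, ProbabilityTheory.integral_gaussianPDFReal_eq_one m hv, mul_one]

end Marginal

/-! ### Padding by zeros, so that parameters of models with different roles can be compared -/

section Pad

variable {α : Type*} [DecidableEq α]

/-- The vector that agrees with `m` on `U`, with `g` on `W`, and vanishes elsewhere. -/
def padVec (U W : Finset α) (m : U → ℝ) (g : W → ℝ) (i : α) : ℝ :=
  if hu : i ∈ U then m ⟨i, hu⟩ else if hw : i ∈ W then g ⟨i, hw⟩ else 0

/-- The block diagonal matrix with blocks `A` on `U` and `B` on `W`, and zeros elsewhere. -/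
def padMat (U W : Finset α) (A : Matrix U U ℝ) (B : Matrix W W ℝ) : Matrix α α ℝ := fun i j =>
  if hu : i ∈ U then (if hj : j ∈ U then A ⟨i, hu⟩ ⟨j, hj⟩ else 0)
  else if hw : i ∈ W then (if hj : j ∈ W then B ⟨i, hw⟩ ⟨j, hj⟩ else 0) else 0

variable {U W T : Finset α}

theorem padVec_left (m : U → ℝ) (g : W → ℝ) (u : U) : padVec U W m g u = m u := by
  simp [padVec]

theorem padVec_right (h : Disjoint U W) (m : U → ℝ) (g : W → ℝ) (w : W) :
    padVec U W m g w = g w := by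
  simp [padVec, Finset.disjoint_right.1 h w.2]

theorem padMat_left (A : Matrix U U ℝ) (B : Matrix W W ℝ) (i j : U) :
    padMat U W A B i j = A i j := by
  simp [padMat]

theorem padMat_right (h : Disjoint U W) (A : Matrix U U ℝ) (B : Matrix W W ℝ) (i j : W) :
    padMat U W A B i j = B i j := by
  simp [padMat, Finset.disjoint_right.1 h i.2]

/-- A disjoint union of two finsets as a sum type. -/
def sumEquivOfUnion (hd : Disjoint U W) (hT : U ∪ W = T) : U ⊕ W ≃ T :=
  (Equiv.Finset.union U W hd).trans (Equiv.subtypeEquivRight (fun i => by rw [hT]))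

theorem sumEquivOfUnion_inl (hd : Disjoint U W) (hT : U ∪ W = T) (u : U) :
    (sumEquivOfUnion hd hT (Sum.inl u) : α) = u := rfl

theorem sumEquivOfUnion_inr (hd : Disjoint U W) (hT : U ∪ W = T) (w : W) :
    (sumEquivOfUnion hd hT (Sum.inr w) : α) = w := rfl

theorem padMat_submatrix (hd : Disjoint U W) (hT : U ∪ W = T) (A : Matrix U U ℝ)
    (B : Matrix W W ℝ) :
    (padMat U W A B).submatrix (fun i => (sumEquivOfUnion hd hT i : α))
      (fun i => (sumEquivOfUnion hd hT i : α)) =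
      Matrix.fromBlocks A 0 (0 : Matrix U W ℝ).transpose B := by
  ext (i | i) (j | j)
  · simp [sumEquivOfUnion_inl, padMat]
  · simp [sumEquivOfUnion_inl, sumEquivOfUnion_inr, padMat, Finset.disjoint_right.1 hd j.2]
  · simp [sumEquivOfUnion_inl, sumEquivOfUnion_inr, padMat, Finset.disjoint_right.1 hd i.2,
      Finset.disjoint_left.1 hd j.2]
  · simp [sumEquivOfUnion_inr, padMat, Finset.disjoint_right.1 hd i.2]

theorem posDef_fromBlocks_zero {ι κ : Type*} [Fintype ι] [Fintype κ] {A : Matrix ι ι ℝ}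
    {B : Matrix κ κ ℝ} (hA : A.PosDef) (hB : B.PosDef) :
    (Matrix.fromBlocks A 0 (0 : Matrix ι κ ℝ).transpose B).PosDef := by
  refine Matrix.PosDef.of_dotProduct_mulVec_pos (Matrix.IsHermitian.fromBlocks hA.1 (by simp) hB.1)
    fun x hx => ?_
  obtain ⟨x₁, x₂, rfl⟩ : ∃ x₁ x₂, x = Sum.elim x₁ x₂ :=
    ⟨_, _, (Sum.elim_comp_inl_inr x).symm⟩
  simp only [star_trivial, Matrix.fromBlocks_mulVec, Sum.elim_comp_inl, Sum.elim_comp_inr,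
    Matrix.transpose_zero, Matrix.zero_mulVec, add_zero, zero_add, sumElim_dotProduct_sumElim]
  have hA' := hA.posSemidef.dotProduct_mulVec_nonneg x₁
  have hB' := hB.posSemidef.dotProduct_mulVec_nonneg x₂
  rw [star_trivial] at hA' hB'
  by_cases h1 : x₁ = 0
  · have h2 : x₂ ≠ 0 := fun h2 => hx (by rw [h1, h2]; simp)
    have := hB.dotProduct_mulVec_pos h2
    rw [star_trivial] at this
    exact add_pos_of_nonneg_of_pos hA' this
  · have := hA.dotProduct_mulVec_pos h1
    rw [star_trivial] at this
    exact add_pos_of_pos_of_nonneg this hB'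

theorem posDef_padMat (hd : Disjoint U W) (hT : U ∪ W = T) {A : Matrix U U ℝ}
    {B : Matrix W W ℝ} (hA : A.PosDef) (hB : B.PosDef) :
    ((padMat U W A B).submatrix ((↑) : T → α) (↑)).PosDef := by
  have h := (posDef_fromBlocks_zero hA hB).submatrix (sumEquivOfUnion hd hT).symm.injective
  rw [← padMat_submatrix hd hT] at h
  convert h using 1
  ext i j
  simp

/-- The product of Gaussian densities on two disjoint sets of coordinates. -/
theorem gaussianDensity_mul_eq_pad (hd : Disjoint U W) (hT : U ∪ W = T) {A : Matrix U U ℝ}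
    {B : Matrix W W ℝ} (hA : A.PosDef) (hB : B.PosDef) (m : U → ℝ) (g : W → ℝ) (y : α → ℝ) :
    gaussianDensity m A (fun u => y u) * gaussianDensity g B (fun w => y w) =
      gaussianDensity (fun i : T => padVec U W m g i)
        ((padMat U W A B).submatrix (↑) (↑)) (fun i : T => y i) := by
  rw [← gaussianDensity_reindex (sumEquivOfUnion hd hT), Matrix.submatrix_submatrix]
  have e1 : (fun i : T => padVec U W m g i) ∘ sumEquivOfUnion hd hT = Sum.elim m g := by
    funext i
    rcases i with i | i
    · exact padVec_left m g i
    · exact padVec_right hd m g i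
  have e2 : (fun i : T => y i) ∘ sumEquivOfUnion hd hT =
      Sum.elim (fun u : U => y u) (fun w : W => y w) := by
    funext i
    rcases i with i | i <;> rfl
  rw [e1, e2]
  have e3 := padMat_submatrix hd hT A B
  rw [show ((↑) : T → α) ∘ sumEquivOfUnion hd hT = fun i => (sumEquivOfUnion hd hT i : α) from rfl,
    e3, gaussianDensity_fromBlocks _ _ _ _ _ hA (by simpa using hB) (posDef_fromBlocks_zero hA hB)]
  simp

end Pad

end SRUW

/-! ### Factorization of the class densities and recovery of the roles -/

namespace SRUW

variable {D : ℕ} {Ψ : Type*} {M M' : Spec D}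

theorem Roles.disjoint_S_compl (V : Roles D) : Disjoint V.S V.Sᶜ := disjoint_compl_right

theorem Roles.union_eq (V : Roles D) : V.U ∪ V.W = V.Sᶜ := by
  have h := V.cover
  have h1 := V.disjoint_SU
  have h2 := V.disjoint_SW
  ext i
  have hi : i ∈ V.S ∪ V.U ∪ V.W := h ▸ Finset.mem_univ i
  simp only [Finset.mem_union, Finset.mem_compl] at hi ⊢
  constructor
  · rintro (hu | hw) hs
    · exact Finset.disjoint_left.1 h1 hs hu
    · exact Finset.disjoint_left.1 h2 hs hw
  · tauto

namespace Param

/-- The density of the variables in `S` in class `k`. -/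
def clusterDensity (θ : Param M Ψ) (k : Fin M.K) (y : Fin D → ℝ) : ℝ :=
  gaussianDensity (θ.μ k) (θ.C k) (fun i => y i)

/-- The mean of the variables outside `S` given those in `S`. -/
def restMean (θ : Param M Ψ) (y : Fin D → ℝ) : Fin D → ℝ :=
  padVec M.V.U M.V.W (θ.a + Matrix.vecMul (fun j : M.V.R => y j) θ.β) θ.γ

/-- The covariance of the variables outside `S` given those in `S`. -/
def restCov (θ : Param M Ψ) : Matrix (Fin D) (Fin D) ℝ :=
  padMat M.V.U M.V.W θ.Ω θ.Γ

/-- The density of the variables outside `S` given those in `S`. -/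
def restDensity (θ : Param M Ψ) (y : Fin D → ℝ) : ℝ :=
  gaussianDensity (fun i : ↥(M.V.Sᶜ) => θ.restMean y i) (θ.restCov.submatrix (↑) (↑))
    (fun i => y i)

theorem restMean_congr (θ : Param M Ψ) {y y' : Fin D → ℝ} (h : ∀ i ∈ M.V.S, y i = y' i) :
    θ.restMean y = θ.restMean y' := by
  unfold restMean
  congr 3
  funext j
  exact h j (M.V.R_subset j.2)

theorem clusterDensity_congr (θ : Param M Ψ) (k : Fin M.K) {y y' : Fin D → ℝ}
    (h : ∀ i ∈ M.V.S, y i = y' i) : θ.clusterDensity k y = θ.clusterDensity k y' := by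
  unfold clusterDensity
  congr 1
  funext j
  exact h j j.2

namespace Admissible

variable {θ : Param M Ψ} {θ' : Param M' Ψ}

theorem classDensity_eq (hθ : θ.Admissible) (k : Fin M.K) (y : Fin D → ℝ) :
    θ.classDensity k y = θ.clusterDensity k y * θ.restDensity y := by
  rw [classDensity, mul_assoc, gaussianDensity_mul_eq_pad M.V.disjoint_UW M.V.union_eq
    hθ.Ω_posDef hθ.Γ_posDef]
  rfl

theorem restCov_posDef (hθ : θ.Admissible) :
    (θ.restCov.submatrix ((↑) : ↥(M.V.Sᶜ) → Fin D) (↑)).PosDef :=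
  posDef_padMat M.V.disjoint_UW M.V.union_eq hθ.Ω_posDef hθ.Γ_posDef

theorem restDensity_pos (hθ : θ.Admissible) (y : Fin D → ℝ) : 0 < θ.restDensity y :=
  gaussianDensity_pos _ hθ.restCov_posDef _

theorem clusterDensity_pos (hθ : θ.Admissible) (k : Fin M.K) (y : Fin D → ℝ) :
    0 < θ.clusterDensity k y :=
  gaussianDensity_pos _ (hθ.C_posDef k) _

theorem isExpPoly_clusterDensity (hθ : θ.Admissible) (k : Fin M.K) :
    IsExpPoly (θ.clusterDensity k) :=
  isExpPoly_gaussianDensity (hθ.C_posDef k) (fun _ => θ.μ k)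
    (fun (y : Fin D → ℝ) i => y i) fun i =>
    ⟨MvPolynomial.X i.1 - MvPolynomial.C (θ.μ k i), fun y => by simp⟩

theorem isExpPoly_classDensity (hθ : θ.Admissible) (k : Fin M.K) :
    IsExpPoly (θ.classDensity k) := by
  refine ((hθ.isExpPoly_clusterDensity k).mul
    (isExpPoly_gaussianDensity hθ.Ω_posDef
      (fun (y : Fin D → ℝ) => θ.a + Matrix.vecMul (fun j : M.V.R => y j) θ.β)
      (fun (y : Fin D → ℝ) i => y i) fun i =>
    ⟨MvPolynomial.X i.1 - (MvPolynomial.C (θ.a i) +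
      ∑ j : M.V.R, MvPolynomial.X j.1 * MvPolynomial.C (θ.β j i)), fun y => by
        simp [Matrix.vecMul, dotProduct]⟩)).mul
    (isExpPoly_gaussianDensity hθ.Γ_posDef (fun _ => θ.γ)
      (fun (y : Fin D → ℝ) i => y i) fun i =>
    ⟨MvPolynomial.X i.1 - MvPolynomial.C (θ.γ i), fun y => by simp⟩)

theorem clusterDensity_proportional (hθ : θ.Admissible) {k l : Fin M.K}
    (h : ∃ c : ℝ, ∀ y, θ.clusterDensity k y = c * θ.clusterDensity l y) : k = l := by
  obtain ⟨c, hc⟩ := h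
  by_contra hkl
  refine hθ.distinct k l hkl ?_
  obtain ⟨h1, h2⟩ := gaussianDensity_proportional (hθ.C_posDef k) (hθ.C_posDef l) (c := c)
    fun x => by
      have := hc (padVec M.V.S ∅ x 0)
      simpa only [clusterDensity, padVec_left] using this
  rw [h1, h2]

theorem classDensity_proportional (hθ : θ.Admissible) {k l : Fin M.K}
    (h : ∃ c : ℝ, ∀ y, θ.classDensity k y = c * θ.classDensity l y) : k = l := by
  obtain ⟨c, hc⟩ := h
  refine hθ.clusterDensity_proportional ⟨c, fun y => ?_⟩
  have := hc y
  rw [hθ.classDensity_eq, hθ.classDensity_eq, ← mul_assoc] at this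
  exact mul_right_cancel₀ (hθ.restDensity_pos y).ne' this

/-- If every class density of one model is proportional to a class density of another one, then
the clustering variables of the former are among those of the latter. -/
theorem S_subset (hθ : θ.Admissible) (hθ' : θ'.Admissible) (g : Fin M.K → Fin M'.K)
    (h : ∀ k, ∃ c : ℝ, 0 < c ∧ ∀ y, θ.classDensity k y = c * θ'.classDensity (g k) y) :
    M.V.S ⊆ M'.V.S := by
  classical
  by_contra hS
  -- The clustering variables shared with the other model.
  set s : Finset M.V.S := Finset.univ.filter (fun i => (i : Fin D) ∈ M'.V.S) with hs
  have hne : s ≠ Finset.univ := fun hu => hS fun i hi => by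
    have : (⟨i, hi⟩ : M.V.S) ∈ s := hu ▸ Finset.mem_univ _
    simpa [hs] using this
  obtain ⟨k, l, -, hkl⟩ := hθ.conditional s hne
  -- The ratio of classes `k` and `l` is free of the rest density in either model. In the second
  -- model it depends only on `M'.V.S`, hence here only on `s`.
  obtain ⟨h1, h2, h3⟩ := conditional_eq_of_ratio (μ := θ.μ k) (μ' := θ.μ l) (hθ.C_posDef k)
    (hθ.C_posDef l) s fun x x' hx => by
      obtain ⟨c, -, hc⟩ := h k
      obtain ⟨c', -, hc'⟩ := h l
      have hy : ∀ i ∈ M'.V.S, padVec M.V.S ∅ x 0 i = padVec M.V.S ∅ x' 0 i := by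
        intro i hi
        by_cases hiS : i ∈ M.V.S
        · have := hx ⟨i, hiS⟩ (by simp [hs, hi])
          simp [padVec, hiS, this]
        · simp [padVec, hiS]
      have e1 := hc (padVec M.V.S ∅ x 0)
      have e2 := hc' (padVec M.V.S ∅ x' 0)
      have e3 := hc' (padVec M.V.S ∅ x 0)
      have e4 := hc (padVec M.V.S ∅ x' 0)
      rw [hθ.classDensity_eq, hθ'.classDensity_eq] at e1 e2 e3 e4
      rw [← θ'.clusterDensity_congr _ hy] at e2 e4
      have hp := hθ.restDensity_pos (padVec M.V.S ∅ x 0)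
      have hp' := hθ.restDensity_pos (padVec M.V.S ∅ x' 0)
      have hN : ∀ (j : Fin M.K) (z : M.V.S → ℝ), θ.clusterDensity j (padVec M.V.S ∅ z 0) =
          gaussianDensity (θ.μ j) (θ.C j) z := fun j z => by
        simp only [clusterDensity, padVec_left]
      rw [hN] at e1 e2 e3 e4
      refine mul_right_cancel₀ (mul_pos hp hp').ne' ?_
      calc _ = (gaussianDensity (θ.μ k) (θ.C k) x * θ.restDensity (padVec M.V.S ∅ x 0)) *
            (gaussianDensity (θ.μ l) (θ.C l) x' * θ.restDensity (padVec M.V.S ∅ x' 0)) := by ring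
        _ = (gaussianDensity (θ.μ l) (θ.C l) x * θ.restDensity (padVec M.V.S ∅ x 0)) *
            (gaussianDensity (θ.μ k) (θ.C k) x' * θ.restDensity (padVec M.V.S ∅ x' 0)) := by
          rw [e1, e2, e3, e4]; ring
        _ = _ := by ring
  tauto

/-- One pair of classes suffices, since the rest density is common to all classes. For fixed values
on `S` the cluster densities are constants, so the two rest densities are proportional Gaussians. -/
theorem rest_eq (hθ : θ.Admissible) (hθ' : θ'.Admissible) (hS : M.V.S = M'.V.S)
    {k : Fin M.K} {k' : Fin M'.K}
    (h : ∃ c : ℝ, 0 < c ∧ ∀ y, θ.classDensity k y = c * θ'.classDensity k' y) :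
    (∀ y, θ.restMean y = θ'.restMean y) ∧ θ.restCov = θ'.restCov := by
  obtain ⟨c, -, hc⟩ := h
  have hU' : M'.V.U ∪ M'.V.W = M.V.Sᶜ := by rw [hS]; exact M'.V.union_eq
  -- Padded parameters vanish on `S`, so comparison on the complement of `S` is enough.
  have zeroVec : ∀ {V : Roles D} {m : V.U → ℝ} {g : V.W → ℝ} {i}, i ∈ V.S →
      padVec V.U V.W m g i = 0 := fun {V m g i} hi => by
    simp [padVec, Finset.disjoint_left.1 V.disjoint_SU hi, Finset.disjoint_left.1 V.disjoint_SW hi]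
  have zeroRow : ∀ {V : Roles D} {m : Matrix V.U V.U ℝ} {g : Matrix V.W V.W ℝ} {i j}, i ∈ V.S →
      padMat V.U V.W m g i j = 0 := fun {V m g i j} hi => by
    simp [padMat, Finset.disjoint_left.1 V.disjoint_SU hi, Finset.disjoint_left.1 V.disjoint_SW hi]
  have zeroCol : ∀ {V : Roles D} {m : Matrix V.U V.U ℝ} {g : Matrix V.W V.W ℝ} {i j}, j ∈ V.S →
      padMat V.U V.W m g i j = 0 := fun {V m g i j} hi => by
    simp [padMat, Finset.disjoint_left.1 V.disjoint_SU hi, Finset.disjoint_left.1 V.disjoint_SW hi]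
  have hpd' : (θ'.restCov.submatrix ((↑) : ↥(M.V.Sᶜ) → Fin D) (↑)).PosDef :=
    posDef_padMat M'.V.disjoint_UW hU' hθ'.Ω_posDef hθ'.Γ_posDef
  have hrest' : ∀ y : Fin D → ℝ, θ'.restDensity y = gaussianDensity (fun i : ↥(M.V.Sᶜ) => θ'.restMean y i)
      (θ'.restCov.submatrix (↑) (↑)) (fun i => y i) := fun y => by
    rw [restDensity, ← hS]
  have key : ∀ y : Fin D → ℝ, (fun i : ↥(M.V.Sᶜ) => θ.restMean y i) =
      (fun i : ↥(M.V.Sᶜ) => θ'.restMean y i) ∧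
      θ.restCov.submatrix ((↑) : ↥(M.V.Sᶜ) → Fin D) ((↑) : ↥(M.V.Sᶜ) → Fin D) =
        θ'.restCov.submatrix ((↑) : ↥(M.V.Sᶜ) → Fin D) ((↑) : ↥(M.V.Sᶜ) → Fin D) := by
    intro y
    refine gaussianDensity_proportional hθ.restCov_posDef hpd'
      (c := c * θ'.clusterDensity k' y / θ.clusterDensity k y) fun z => ?_
    set w := padVec M.V.S M.V.Sᶜ (fun i => y i) z with hw
    have hwS : ∀ i ∈ M.V.S, w i = y i := fun i hi => padVec_left _ _ ⟨i, hi⟩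
    have hwz : (fun i : ↥(M.V.Sᶜ) => w i) = z := by
      funext i
      exact padVec_right M.V.disjoint_S_compl _ _ i
    have h1 := hc w
    rw [hθ.classDensity_eq, hθ'.classDensity_eq, hrest', restDensity, hwz,
      θ.restMean_congr hwS, θ'.restMean_congr (hS ▸ hwS), θ.clusterDensity_congr k hwS,
      θ'.clusterDensity_congr k' (hS ▸ hwS)] at h1
    have := hθ.clusterDensity_pos k y
    field_simp
    linear_combination h1
  refine ⟨fun y => ?_, ?_⟩
  · funext i
    by_cases hi : i ∈ M.V.S
    · rw [restMean, restMean, zeroVec hi, zeroVec (hS ▸ hi)]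
    · exact congrFun (key y).1 ⟨i, Finset.mem_compl.2 hi⟩
  · ext i j
    by_cases hi : i ∈ M.V.S
    · rw [restCov, restCov, zeroRow hi, zeroRow (hS ▸ hi)]
    by_cases hj : j ∈ M.V.S
    · rw [restCov, restCov, zeroCol hj, zeroCol (hS ▸ hj)]
    exact congrFun (congrFun (key 0).2 ⟨i, Finset.mem_compl.2 hi⟩) ⟨j, Finset.mem_compl.2 hj⟩

end Admissible

/-- Together with `restMean_sub_of_notMem`, this lets the mean function alone detect the regression:
`β` has no zero row or column, so `U` and `R` are exactly the indices of nonzero increments. -/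
theorem restMean_single_sub (θ : Param M Ψ) (j : M.V.R) (u : M.V.U) :
    θ.restMean (Pi.single j 1) u - θ.restMean 0 u = θ.β j u := by
  have h : (fun i : M.V.R => (Pi.single (j : Fin D) (1 : ℝ) : Fin D → ℝ) i) = Pi.single j 1 := by
    funext i
    by_cases hi : i = j
    · subst hi; simp
    · rw [Pi.single_eq_of_ne hi, Pi.single_eq_of_ne (fun e => hi (Subtype.ext e))]
  have h0 : (fun i : M.V.R => (0 : Fin D → ℝ) i.1) = (0 : M.V.R → ℝ) := rfl
  rw [restMean, restMean, padVec_left, padVec_left, h, h0]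
  simp

theorem restMean_sub_of_notMem (θ : Param M Ψ) {j u : Fin D} (h : u ∉ M.V.U ∨ j ∉ M.V.R) :
    θ.restMean (Pi.single j 1) u - θ.restMean 0 u = 0 := by
  rcases h with h | h
  · simp [restMean, padVec, h]
  · have : (fun i : M.V.R => (Pi.single j (1 : ℝ) : Fin D → ℝ) i) =
        fun i : M.V.R => (0 : Fin D → ℝ) i.1 := by
      funext i
      rw [Pi.single_eq_of_ne (fun e => h (by rw [← e]; exact i.2))]
      rfl
    rw [restMean, restMean, this, sub_self]

namespace Admissible

variable {θ : Param M Ψ} {θ' : Param M' Ψ}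

theorem U_subset (hθ : θ.Admissible) (h : ∀ y, θ.restMean y = θ'.restMean y) :
    M.V.U ⊆ M'.V.U := by
  intro u hu
  by_contra hu'
  obtain ⟨j, hj⟩ := hθ.β_col ⟨u, hu⟩ ⟨u, hu⟩
  rw [← restMean_single_sub, h, h] at hj
  exact hj (θ'.restMean_sub_of_notMem (Or.inl hu'))

theorem R_subset (hθ : θ.Admissible) (h : ∀ y, θ.restMean y = θ'.restMean y) :
    M.V.R ⊆ M'.V.R := by
  intro j hj
  by_contra hj'
  have hU : M.V.U.Nonempty := by
    rw [Finset.nonempty_iff_ne_empty]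
    intro hU
    rw [M.V.R_empty hU] at hj
    exact Finset.notMem_empty _ hj
  obtain ⟨u, hu⟩ := hθ.β_row hU ⟨j, hj⟩
  rw [← restMean_single_sub, h, h] at hu
  exact hu (θ'.restMean_sub_of_notMem (Or.inr hj'))

end Admissible

end Param

theorem Roles.ext_of_eq {V V' : Roles D} (hS : V.S = V'.S) (hU : V.U = V'.U) (hR : V.R = V'.R) :
    V = V' := by
  have hW : ∀ V : Roles D, V.W = V.Sᶜ \ V.U := fun V => by
    rw [← V.union_eq, Finset.union_sdiff_cancel_left V.disjoint_UW]
  have hWW : V.W = V'.W := by rw [hW, hW V', hS, hU]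
  cases V
  cases V'
  simp_all

theorem padVec_injective {α : Type*} [DecidableEq α] {U W : Finset α} (hd : Disjoint U W)
    {m m' : U → ℝ} {g g' : W → ℝ} (h : padVec U W m g = padVec U W m' g') : m = m' ∧ g = g' := by
  refine ⟨funext fun u => ?_, funext fun w => ?_⟩
  · rw [← padVec_left m g u, h, padVec_left]
  · rw [← padVec_right hd m g w, h, padVec_right hd]

theorem padMat_injective {α : Type*} [DecidableEq α] {U W : Finset α} (hd : Disjoint U W)
    {A A' : Matrix U U ℝ} {B B' : Matrix W W ℝ} (h : padMat U W A B = padMat U W A' B') :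
    A = A' ∧ B = B' := by
  refine ⟨Matrix.ext fun i j => ?_, Matrix.ext fun i j => ?_⟩
  · rw [← padMat_left A B i j, h, padMat_left]
  · rw [← padMat_right hd A B i j, h, padMat_right hd]

end SRUW

/-! ### Missingness patterns, covariance forms and the mechanism -/

namespace SRUW

variable {D : ℕ} {Ψ : Type*} {M M' : Spec D}

theorem maskProb_none (t : ℝ) : maskProb t (fun _ : Fin D => false) = (1 - t) ^ D := by
  simp [maskProb]

/-- The odds of a missing entry, without division: this is what a single missing variable reveals
about `t`. -/
theorem maskProb_single (t : ℝ) (d : Fin D) :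
    maskProb t (fun i => decide (i = d)) * (1 - t) = t * maskProb t (fun _ : Fin D => false) := by
  unfold maskProb
  rw [← Finset.mul_prod_erase _ _ (Finset.mem_univ d),
    ← Finset.mul_prod_erase Finset.univ (fun i : Fin D => if false = true then t else 1 - t)
      (Finset.mem_univ d),
    Finset.prod_congr rfl (g := fun i : Fin D => if false = true then t else 1 - t) fun i hi => by
      simp [Finset.ne_of_mem_erase hi]]
  simp
  ring

theorem integral_assemble_single (F : (Fin D → ℝ) → ℝ) (d : Fin D) (y : Fin D → ℝ) :
    ∫ ym : {i // decide (i = d) = true} → ℝ,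
      F (assemble (fun i => decide (i = d)) (fun i => y i) ym) =
      ∫ t, F (Function.update y d t) := by
  let : Unique {i // decide (i = d) = true} :=
    ⟨⟨⟨d, by simp⟩⟩, fun i => Subtype.ext (by simpa using i.2)⟩
  rw [← (volume_preserving_funUnique {i // decide (i = d) = true} ℝ).integral_comp'
    (fun t => F (Function.update y d t))]
  congr 1
  · congr!
  funext ym
  congr 1
  funext i
  by_cases hi : i = d
  · subst hi
    simp only [assemble, decide_true, dite_true, Function.update_self]
    rfl
  · simp [assemble, hi]

namespace Param

theorem observedDensity_complete (θ : Param M Ψ) (ρ : Ψ → ℝ) (y : Fin D → ℝ) :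
    θ.observedDensity ρ (fun _ => false) (fun i => y i) =
      ∑ k, θ.p k * (1 - ρ (θ.ψ k)) ^ D * θ.classDensity k y := by
  have h : ∀ ym : {d : Fin D // false = true} → ℝ,
      assemble (fun _ => false) (fun i => y i) ym = y := fun ym => by
    funext i
    simp [assemble]
  have : IsEmpty {d : Fin D // false = true} := ⟨fun d => Bool.false_ne_true d.2⟩
  simp only [observedDensity, h, maskProb_none]
  rw [integral_const, volume_pi, Measure.pi_of_empty]
  simp only [probReal_univ, one_smul]
  exact Finset.sum_congr rfl fun k _ => by ring

theorem observedDensity_single (θ : Param M Ψ) (ρ : Ψ → ℝ) (d : Fin D) (y : Fin D → ℝ) :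
    θ.observedDensity ρ (fun i => decide (i = d)) (fun i => y i) =
      ∫ t, ∑ k, θ.p k * maskProb (ρ (θ.ψ k)) (fun i => decide (i = d)) *
        θ.classDensity k (Function.update y d t) := by
  rw [observedDensity, ← integral_assemble_single (fun z => ∑ k, θ.p k *
    maskProb (ρ (θ.ψ k)) (fun i => decide (i = d)) * θ.classDensity k z)]
  congr 1
  funext ym
  exact Finset.sum_congr rfl fun k _ => by ring

end Param

theorem gaussianDensity_of_isEmpty {ι : Type*} [Fintype ι] [DecidableEq ι] [IsEmpty ι]
    (μ : ι → ℝ) (C : Matrix ι ι ℝ) (x : ι → ℝ) : gaussianDensity μ C x = 1 := by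
  simp [gaussianDensity, dotProduct]

theorem update_comp_subtype {T : Finset (Fin D)} {d : Fin D} (hd : d ∈ T) (y : Fin D → ℝ) (t : ℝ) :
    (fun i : T => Function.update y d t i) =
      Function.update (fun i : T => y i) ⟨d, hd⟩ t := by
  funext i
  by_cases hi : i = ⟨d, hd⟩
  · subst hi; simp
  · rw [Function.update_of_ne hi, Function.update_of_ne fun e => hi (Subtype.ext e)]

namespace Param.Admissible

variable {θ : Param M Ψ}

theorem linearIndependent_clusterDensity (hθ : θ.Admissible) :
    LinearIndependent ℝ θ.clusterDensity :=
  IsExpPoly.linearIndependent hθ.isExpPoly_clusterDensity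
    fun _ _ h => hθ.clusterDensity_proportional h

theorem linearIndependent_classDensity (hθ : θ.Admissible) :
    LinearIndependent ℝ θ.classDensity :=
  IsExpPoly.linearIndependent hθ.isExpPoly_classDensity
    fun _ _ h => hθ.classDensity_proportional h

/-- If some variable can go missing without making two classes coincide, then integrating it out
maps the class densities to linearly independent functions. -/
theorem exists_marginal (hθ : θ.Admissible) (hsep : θ.SeparatedWhenIncomplete) :
    ∃ (d : Fin D) (g : Fin M.K → (Fin D → ℝ) → ℝ) (H : (Fin D → ℝ) → ℝ),
      LinearIndependent ℝ g ∧ (∀ y, 0 < H y) ∧ ∀ (w : Fin M.K → ℝ) (y : Fin D → ℝ),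
        ∫ t, ∑ k, w k * θ.classDensity k (Function.update y d t) = H y * ∑ k, w k * g k y := by
  by_cases hS : M.V.S = Finset.univ
  -- All variables cluster, so the rest density is an empty Gaussian, equal to one. The marginals
  -- without `d` are Gaussians that the separation hypothesis keeps distinct.
  · obtain ⟨d, hd⟩ := hsep.resolve_left (not_not.2 hS)
    have hrest : ∀ y, θ.restDensity y = 1 := fun y => by
      have : IsEmpty ↥(M.V.Sᶜ) := by
        rw [hS, Finset.compl_univ]
        infer_instance
      exact gaussianDensity_of_isEmpty _ _ _
    set s := Finset.univ.erase d with hs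
    let g : Fin M.K → (Fin D → ℝ) → ℝ := fun k y =>
      gaussianDensity (fun i : {i // i ∈ s} => θ.μ k i)
        ((θ.C k).toBlock (· ∈ s) (· ∈ s)) (fun i => y i.1)
    refine ⟨d, g, fun _ => 1, ?_, fun _ => one_pos, fun w y => ?_⟩
    · refine IsExpPoly.linearIndependent (fun k => isExpPoly_gaussianDensity
        (posDef_toBlock (hθ.C_posDef k) s) _ _ fun i =>
        ⟨MvPolynomial.X i.1.1 - MvPolynomial.C (θ.μ k i), fun y => by simp⟩) ?_
      rintro k l ⟨c, hc⟩
      by_contra hkl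
      obtain ⟨h1, h2⟩ := gaussianDensity_proportional (posDef_toBlock (hθ.C_posDef k) s)
        (posDef_toBlock (hθ.C_posDef l) s) (μ := fun i : {i // i ∈ s} => θ.μ k i)
        (μ' := fun i : {i // i ∈ s} => θ.μ l i) (c := c) fun x => by
          have := hc (padVec M.V.S ∅ (padVec s ∅ x 0) 0)
          have e : (fun i : {i // i ∈ s} => padVec M.V.S ∅ (padVec s ∅ x 0) 0 i.1) = x := by
            funext i
            rw [padVec_left, padVec_left]
          simpa only [g, e] using this
      rcases hd k l hkl with ⟨i, hi, hne⟩ | ⟨i, j, hi, hj, hne⟩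
      · exact hne (congrFun h1 ⟨i, by simp [hs, hi]⟩)
      · exact hne (congrFun (congrFun h2 ⟨i, by simp [hs, hi]⟩) ⟨j, by simp [hs, hj]⟩)
    · have e : ∀ k t, θ.classDensity k (Function.update y d t) =
          gaussianDensity (θ.μ k) (θ.C k) (Function.update (fun i : M.V.S => y i) d t) :=
        fun k t => by
          rw [hθ.classDensity_eq, hrest, mul_one, clusterDensity, update_comp_subtype d.2]
      simp only [e, one_mul]
      rw [integral_finsetSum _ fun k _ =>
        (integrable_gaussianDensity_update _ (hθ.C_posDef k) _ _).const_mul _]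
      refine Finset.sum_congr rfl fun k _ => ?_
      rw [integral_const_mul, integral_gaussianDensity_update _ (hθ.C_posDef k)]
  -- For `d` outside `S` the integral touches only the common rest density, and the cluster
  -- densities remain as they are.
  · obtain ⟨d, hd⟩ : ∃ d, d ∉ M.V.S := by
      by_contra! h
      exact hS (Finset.eq_univ_iff_forall.2 h)
    have hdT := Finset.mem_compl.2 hd
    refine ⟨d, θ.clusterDensity, fun y => ∫ t, θ.restDensity (Function.update y d t),
      hθ.linearIndependent_clusterDensity, fun y => ?_, fun w y => ?_⟩
    · have e : ∀ t, θ.restDensity (Function.update y d t) =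
          gaussianDensity (fun i : ↥(M.V.Sᶜ) => θ.restMean y i) (θ.restCov.submatrix (↑) (↑))
            (Function.update (fun i : ↥(M.V.Sᶜ) => y i) ⟨d, hdT⟩ t) := fun t => by
        rw [restDensity, update_comp_subtype hdT, θ.restMean_congr (y' := y)]
        exact fun i hi => Function.update_of_ne (fun h : i = d => hd (h ▸ hi)) _ _
      simp only [e]
      rw [integral_gaussianDensity_update _ hθ.restCov_posDef]
      exact gaussianDensity_pos _ (posDef_toBlock hθ.restCov_posDef _) _
    · have e : ∀ k t, θ.clusterDensity k (Function.update y d t) = θ.clusterDensity k y :=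
        fun k t => θ.clusterDensity_congr k fun i hi =>
          Function.update_of_ne (fun h : i = d => hd (h ▸ hi)) _ _
      simp only [hθ.classDensity_eq, e, ← mul_assoc, ← Finset.sum_mul]
      rw [integral_const_mul, mul_comm]

end Param.Admissible

theorem weights_eq_of_linearIndependent {κ X : Type*} [Fintype κ] {f : κ → X → ℝ}
    (hf : LinearIndependent ℝ f) (σ : Equiv.Perm κ) {w w' : κ → ℝ}
    (h : ∀ x, ∑ k, w k * f k x = ∑ k, w' k * f (σ k) x) (k : κ) : w' k = w (σ k) := by
  have h0 : ∑ k, (w k - w' (σ.symm k)) • f k = 0 := by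
    funext x
    have e := Equiv.sum_comp σ (fun k => w' (σ.symm k) * f k x)
    simp only [Equiv.symm_apply_apply] at e
    simp [sub_mul, h x, e]
  have := Fintype.linearIndependent_iff.1 hf _ h0 (σ k)
  rw [Equiv.symm_apply_apply] at this
  linarith

theorem Level.Holds.perm {κ κ' α : Type*} {e : α} {f : κ → α} {l : Level} (h : l.Holds e f)
    (σ : κ' → κ) : l.Holds e (fun k => f (σ k)) := by
  cases l
  · exact fun k => h (σ k)
  · exact fun k k' => h (σ k) (σ k')
  · trivial

theorem MixForm.Respects.perm {κ κ' ι : Type*} [Fintype ι] [DecidableEq ι] {m : MixForm}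
    {C : κ → Matrix ι ι ℝ} (h : m.Respects C) (σ : κ' → κ) : m.Respects (fun k => C (σ k)) := by
  obtain ⟨vol, A, Q, h1, h2, h3, h4, h5, h6, h7, h8⟩ := h
  exact ⟨fun k => vol (σ k), fun k => A (σ k), fun k => Q (σ k), fun k => h1 _, fun k => h2 _,
    fun k => h3 _, fun k => h4 _, fun k => h5 _, h6.perm σ, h7.perm σ, h8.perm σ⟩

theorem MixForm.le_antisymm {m m' : MixForm} (h : m.le m') (h' : m'.le m) : m = m' := by
  have hr : ∀ {a b : Level}, a.rank ≤ b.rank → b.rank ≤ a.rank → a = b := fun {a b} h1 h2 => by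
    cases a <;> cases b <;> simp_all [Level.rank]
  cases m
  cases m'
  simp only [MixForm.mk.injEq]
  exact ⟨hr h.1 h'.1, hr h.2.1 h'.2.1, hr h.2.2 h'.2.2⟩

/-- Relabelling the classes preserves every form, so each of two least forms is a special case of
the other. -/
theorem MixForm.Exact.eq {κ ι : Type*} [Fintype ι] [DecidableEq ι] {m m' : MixForm}
    {C C' : κ → Matrix ι ι ℝ} (h : m.Exact C) (h' : m'.Exact C') (σ : Equiv.Perm κ)
    (hC : ∀ k, C' k = C (σ k)) : m = m' := by
  have e : C' = fun k => C (σ k) := funext hC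
  have e' : C = fun k => C' (σ.symm k) := funext fun k => by rw [hC, Equiv.apply_symm_apply]
  refine MixForm.le_antisymm (h.2 _ ?_) (h'.2 _ ?_)
  · rw [e']; exact h'.1.perm _
  · rw [e]; exact h.1.perm _

/-- The three exact forms are mutually exclusive: zero off-diagonal entries separate `LC` from the
others, and equal diagonal entries separate `LI` from `LB`. -/
theorem CovForm.Exact.eq {ι : Type*} [DecidableEq ι] {C : Matrix ι ι ℝ} {r r' : CovForm}
    (h : r.Exact C) (h' : r'.Exact C) : r = r' := by
  have h1 : ∀ t : ℝ, C = t • (1 : Matrix ι ι ℝ) → ∀ i j, i ≠ j → C i j = 0 := fun t ht i j hij => by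
    simp [ht, hij]
  have h2 : ∀ t : ℝ, C = t • (1 : Matrix ι ι ℝ) → ∀ i j, C i i = C j j := fun t ht i j => by
    simp [ht]
  cases r <;> cases r' <;> simp only [CovForm.Exact] at h h' <;> first | rfl | grind

/-- Two models with the same specification and the same parameters of the data, up to a
permutation of the labels, have the same proportions and missingness parameters if some variable
can go missing without making two classes coincide. -/
theorem Param.Admissible.mechanism_eq {ρ : Ψ → ℝ} (hρ_inj : Function.Injective ρ)
    (hρ : ∀ x, 0 ≤ ρ x ∧ ρ x < 1) {θ θ' : Param M Ψ} (hθ : θ.Admissible)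
    (heq : ∀ (c : Fin D → Bool) (yo : {d // c d = false} → ℝ),
      θ.observedDensity ρ c yo = θ'.observedDensity ρ c yo)
    (σ : Equiv.Perm (Fin M.K)) (hf : ∀ k y, θ'.classDensity k y = θ.classDensity (σ k) y)
    (hsep : θ.SeparatedWhenIncomplete) (k : Fin M.K) :
    θ'.p k = θ.p (σ k) ∧ θ'.ψ k = θ.ψ (σ k) := by
  have h0 : θ'.p k * (1 - ρ (θ'.ψ k)) ^ D = θ.p (σ k) * (1 - ρ (θ.ψ (σ k))) ^ D :=
    weights_eq_of_linearIndependent hθ.linearIndependent_classDensity σ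
      (w := fun k => θ.p k * (1 - ρ (θ.ψ k)) ^ D) (w' := fun k => θ'.p k * (1 - ρ (θ'.ψ k)) ^ D)
      (fun y => by
        have := heq (fun _ => false) (fun i => y i)
        rw [observedDensity_complete, observedDensity_complete] at this
        simpa only [hf] using this) k
  obtain ⟨d, g, H, hg, hH, hint⟩ := hθ.exists_marginal hsep
  let c : Fin D → Bool := fun i => decide (i = d)
  have h1 : θ'.p k * maskProb (ρ (θ'.ψ k)) c = θ.p (σ k) * maskProb (ρ (θ.ψ (σ k))) c :=
    weights_eq_of_linearIndependent hg σ
      (w := fun k => θ.p k * maskProb (ρ (θ.ψ k)) c)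
      (w' := fun k => θ'.p k * maskProb (ρ (θ'.ψ k)) c)
      (fun y => by
        have h2 := heq c (fun i => y i)
        rw [observedDensity_single, observedDensity_single] at h2
        have e : ∀ (w : Fin M.K → ℝ) (F : Fin M.K → ℝ),
            ∑ k, w k * F (σ k) = ∑ k, w (σ.symm k) * F k := fun w F => by
          rw [← Equiv.sum_comp σ (fun k => w (σ.symm k) * F k)]
          simp only [Equiv.symm_apply_apply]
        simp only [hf] at h2
        have h3 := h2.trans (integral_congr_ae (.of_forall fun t =>
          e (fun k => θ'.p k * maskProb (ρ (θ'.ψ k)) c)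
            (fun k => θ.classDensity k (Function.update y d t))))
        rw [hint, hint] at h3
        rw [e _ (fun k => g k y)]
        exact mul_left_cancel₀ (hH y).ne' h3) k
  have hm := maskProb_single (ρ (θ.ψ (σ k))) d
  have hm' := maskProb_single (ρ (θ'.ψ k)) d
  rw [maskProb_none] at hm hm'
  have ht := (hρ (θ.ψ (σ k))).2
  have ht' := (hρ (θ'.ψ k)).2
  have hp := hθ.p_pos (σ k)
  have hpos : 0 < θ.p (σ k) * (1 - ρ (θ.ψ (σ k))) ^ D :=
    mul_pos hp (pow_pos (sub_pos.2 ht) _)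
  change maskProb (ρ (θ.ψ (σ k))) c * _ = _ at hm
  change maskProb (ρ (θ'.ψ k)) c * _ = _ at hm'
  -- Dividing `h1` by `h0` would equate the odds `t / (1 - t)` and `t' / (1 - t')`; after clearing
  -- denominators the terms in `t * t'` cancel.
  have hψ : θ'.ψ k = θ.ψ (σ k) := by
    refine hρ_inj (mul_left_cancel₀ hpos.ne' ?_)
    generalize maskProb (ρ (θ.ψ (σ k))) c = m at *
    generalize maskProb (ρ (θ'.ψ k)) c = m' at *
    generalize ρ (θ.ψ (σ k)) = t at *
    generalize ρ (θ'.ψ k) = t' at *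
    generalize (1 - t) ^ D = b at *
    generalize (1 - t') ^ D = b' at *
    linear_combination (1 - t') * θ.p (σ k) * hm - (1 - t) * θ'.p k * hm' -
      t' * (1 - t) * h0 + (1 - t) * (1 - t') * h1
  refine ⟨?_, hψ⟩
  rw [hψ] at h0
  exact mul_right_cancel₀ (pow_pos (sub_pos.2 ht) _).ne' h0

/-- Observationally equivalent admissible models have the same class densities, up to a bijection
of the classes and proportionality. -/
theorem Param.Admissible.exists_equiv {ρ : Ψ → ℝ} (hρ : ∀ x, 0 ≤ ρ x ∧ ρ x < 1)
    {θ : Param M Ψ} {θ' : Param M' Ψ} (hθ : θ.Admissible) (hθ' : θ'.Admissible)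
    (heq : ∀ (c : Fin D → Bool) (yo : {d // c d = false} → ℝ),
      θ.observedDensity ρ c yo = θ'.observedDensity ρ c yo) :
    ∃ e : Fin M'.K ≃ Fin M.K, ∀ k, ∃ c : ℝ, 0 < c ∧
      ∀ y, θ'.classDensity k y = c * θ.classDensity (e k) y :=
  IsExpPoly.exists_equiv hθ.isExpPoly_classDensity hθ'.isExpPoly_classDensity
    (fun _ _ h => hθ.classDensity_proportional h) (fun _ _ h => hθ'.classDensity_proportional h)
    -- Weights of the complete-data pattern, positive because `ρ < 1`.
    (w := fun k => θ.p k * (1 - ρ (θ.ψ k)) ^ D) (w' := fun k => θ'.p k * (1 - ρ (θ'.ψ k)) ^ D)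
    (fun k => mul_pos (hθ.p_pos k) (pow_pos (sub_pos.2 (hρ _).2) _))
    (fun k => mul_pos (hθ'.p_pos k) (pow_pos (sub_pos.2 (hρ _).2) _))
    fun y => by
      have := heq (fun _ => false) (fun i => y i)
      rwa [observedDensity_complete, observedDensity_complete] at this

/-- Observationally equivalent admissible models have the same roles of the variables. -/
theorem Param.Admissible.roles_eq {θ : Param M Ψ} {θ' : Param M' Ψ} (hθ : θ.Admissible)
    (hθ' : θ'.Admissible) (e : Fin M'.K ≃ Fin M.K) (he : ∀ k, ∃ c : ℝ, 0 < c ∧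
      ∀ y, θ'.classDensity k y = c * θ.classDensity (e k) y) :
    M.V = M'.V ∧ (∀ y, θ'.restMean y = θ.restMean y) ∧ θ'.restCov = θ.restCov := by
  have he' : ∀ k, ∃ c : ℝ, 0 < c ∧ ∀ y, θ.classDensity k y = c * θ'.classDensity (e.symm k) y := by
    intro k
    obtain ⟨c, hc, h⟩ := he (e.symm k)
    refine ⟨c⁻¹, inv_pos.2 hc, fun y => ?_⟩
    rw [h, Equiv.apply_symm_apply, inv_mul_cancel_left₀ hc.ne']
  have hS : M.V.S = M'.V.S :=
    (hθ.S_subset hθ' e.symm he').antisymm (hθ'.S_subset hθ e he)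
  obtain ⟨k⟩ : Nonempty (Fin M'.K) := by
    by_contra h
    rw [not_nonempty_iff] at h
    simpa using hθ'.p_sum
  obtain ⟨h1, h2⟩ := hθ'.rest_eq hθ hS.symm (he k)
  have h1' := fun y => (h1 y).symm
  exact ⟨Roles.ext_of_eq hS ((hθ.U_subset h1').antisymm (hθ'.U_subset h1))
    ((hθ.R_subset h1').antisymm (hθ'.R_subset h1)), h1, h2⟩

end SRUW

/-! ### Assembly of the main theorem -/

theorem theorem1 {D : ℕ} {Ψ : Type*} (ρ : Ψ → ℝ) (hρ_inj : Function.Injective ρ)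
    (hρ : ∀ x, 0 ≤ ρ x ∧ ρ x < 1)
    (M M' : SRUW.Spec D) (θ : SRUW.Param M Ψ) (θ' : SRUW.Param M' Ψ)
    (hθ : θ.Admissible) (hθ' : θ'.Admissible)
    (heq : ∀ (c : Fin D → Bool) (yo : {d // c d = false} → ℝ),
      θ.observedDensity ρ c yo = θ'.observedDensity ρ c yo) :
    ∃ (h : M = M') (σ : Equiv.Perm (Fin M.K)),
      (∀ k, (θ'.cast h).μ k = θ.μ (σ k)) ∧
      (∀ k, (θ'.cast h).C k = θ.C (σ k)) ∧
      (θ'.cast h).a = θ.a ∧ (θ'.cast h).β = θ.β ∧ (θ'.cast h).Ω = θ.Ω ∧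
      (θ'.cast h).γ = θ.γ ∧ (θ'.cast h).Γ = θ.Γ ∧
      (θ.SeparatedWhenIncomplete →
        (∀ k, (θ'.cast h).p k = θ.p (σ k)) ∧
        (∀ k, (θ'.cast h).ψ k = θ.ψ (σ k))) := by
  open SRUW Param Admissible in
  obtain ⟨σ, he⟩ := hθ.exists_equiv hρ hθ' heq
  obtain ⟨hV, hmean, hcov⟩ := hθ.roles_eq hθ' σ he
  have hK : M.K = M'.K := by simpa using (Fintype.card_congr σ).symm
  -- Identifying `K` and `V` first gives both parameter sets the same index types, so they can be
  -- compared before the forms are known to agree.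
  obtain ⟨K, m, r, l, V⟩ := M
  obtain ⟨K', m', r', l', V'⟩ := M'
  dsimp only at hV hK
  subst hV hK
  -- The rest densities are now equal and cancel, leaving proportional Gaussians on `S`; the padding
  -- outside `S` is immaterial.
  have hμC : ∀ k, θ'.μ k = θ.μ (σ k) ∧ θ'.C k = θ.C (σ k) := fun k => by
    obtain ⟨c, -, hc⟩ := he k
    refine gaussianDensity_proportional (hθ'.C_posDef k) (hθ.C_posDef (σ k)) (c := c) fun x => ?_
    have h1 := hc (padVec V.S ∅ x 0)
    have hr : θ'.restDensity (padVec V.S ∅ x 0) = θ.restDensity (padVec V.S ∅ x 0) := by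
      rw [restDensity, restDensity, hmean, hcov]
    rw [hθ.classDensity_eq, hθ'.classDensity_eq, hr, ← mul_assoc] at h1
    have h2 := mul_right_cancel₀ (hθ.restDensity_pos _).ne' h1
    simpa only [clusterDensity, padVec_left] using h2
  obtain ⟨hΩ, hΓ⟩ := padMat_injective V.disjoint_UW hcov
  have hγ := (padVec_injective V.disjoint_UW (hmean 0)).2
  have ha : θ'.a = θ.a := by
    have h1 := (padVec_injective V.disjoint_UW (hmean 0)).1
    have h0 : (fun j : V.R => (0 : Fin D → ℝ) j.1) = (0 : V.R → ℝ) := rfl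
    simpa only [h0, Matrix.zero_vecMul, add_zero] using h1
  have hβ : θ'.β = θ.β := by
    ext j u
    exact (θ'.restMean_single_sub j u).symm.trans
      (by rw [hmean, hmean]; exact θ.restMean_single_sub j u)
  obtain rfl : m = m' := hθ.m_exact.eq hθ'.m_exact σ fun k => (hμC k).2
  obtain rfl : r = r' := hθ.r_exact.eq (hΩ ▸ hθ'.r_exact)
  obtain rfl : l = l' := hθ.l_exact.eq (hΓ ▸ hθ'.l_exact)
  refine ⟨rfl, σ, fun k => (hμC k).1, fun k => (hμC k).2, ha, hβ, hΩ, hγ, hΓ, fun hsep => ?_⟩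
  -- All data parameters agree, so matched class densities are equal and not merely proportional.
  have hmech := hθ.mechanism_eq hρ_inj hρ heq σ (fun k y => by
    rw [classDensity, classDensity, (hμC k).1, (hμC k).2, ha, hβ, hΩ, hγ, hΓ]) hsep
  exact ⟨fun k => (hmech k).1, fun k => (hmech k).2⟩

end
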